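/- **Setting.** Let $G$ be a simple bipartite graph on $\{0,\dots,N-1\}$ with colour classes $V_1,V_2$ (non-empty, disjoint, covering all vertices), $n_i=|V_i|$. Assume that every $x\in V_1$ has degree $d_1$, put $d_2=\max_{y\in V_2}\deg(y)$, and assume $d_2\le d_1-1$. The graph $G_n$ has as vertices all words $\underline x=(x_1\dots x_n)$ over $\{0,\dots,N-1\}$; every vertex has a loop, and two different words $\underline x,\underline y$ with longest common prefix of length $p$ are adjacent iff one of the postfixes $(x_{p+1}\dots x_n)$, $(y_{p+1}\dots y_n)$ has all its letters in $V_1$, the other one has all its letters in $V_2$, and $x_iy_i$ is an edge of $G$ for every $i>p$. Let $M_n$ be non-negative integers, $M_n=c_nN^n$ with $c_n\to\infty$. Let $X^{(0)},\dots,X^{(M_n)}$ be i.i.d. uniform on $[0,1]$. The random graph $G_n^{\mathrm r}$ has the vertices $0,\dots,M_n$, and $i\ne j$ are adjacent iff the words formed by the first $n$ $N$-adic digits of $X^{(i)}$ and $X^{(j)}$ are adjacent in $G_n$ (in particular if they are equal). Let $V$ be a uniformly chosen vertex, independent of the $X^{(i)}$. Put $$t_k=\frac{d_1^{k+1}-1}{d_1-1},\qquad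 k_0(n)=\max\Big\{(n+1)\frac{\log d_2}{\log d_1},\frac{\log n}{\log d_1}\Big\},\qquad I_{k,n}=\big[c_nt_k-K\sqrt{c_nt_k},\,c_nt_k+K\sqrt{c_nt_k}\big],$$ where $K$ is a fixed constant with $\mathbb P(|Z|>K)<e^{-10}$ for a standard normal $Z$, and let $\phi$ be the standard normal density. **Theorem (local Gaussian degree masses).** (i) There is a constant $C$, depending only on $G,V_1,V_2,K$, such that for every such sequence $M_n=c_nN^n$ and all sufficiently large $n$ (how large may depend on the sequence), for all integers $k$ with $k_0(n)<k<n$ and all integers $u\ge0$ with $u\in I_{k,n}$, $$\mathbb P(\deg V=u)=\Big(\frac{n_1}{N}\Big)^k\frac{n_2}{N}\cdot\frac{1}{\sqrt{c_nt_k(1-\frac{t_k}{N^n})}}\;\phi\Big(\frac{u-c_nt_k}{\sqrt{c_nt_k(1-\frac{t_k}{N^n})}}\Big)(1+\varepsilon),\qquad |\varepsilon|\le\frac{C}{\sqrt{c_nt_k}} .$$ (ii) For every $A$ there is a constant $C$, depending only on $G,V_1,V_2,K,A$, such that for every such sequence, all sufficiently large $n$, all $k$ with $k_0(n)<k<n$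 and $\frac{t_k}{N^n}\le\frac{A}{\sqrt{c_nt_k}}$, and all integers $u\ge 0$ with $u\in I_{k,n}$, $$\mathbb P(\deg V=u)=\Big(\frac{n_1}{N}\Big)^k\frac{n_2}{N}\cdot\frac{1}{\sqrt{c_nt_k}}\;\phi\Big(\frac{u-c_nt_k}{\sqrt{c_nt_k(1-\frac{t_k}{N^n})}}\Big)(1+\varepsilon),\qquad |\varepsilon|\le\frac{C}{\sqrt{c_nt_k}} .$$ So each Dirac mass of the degree distribution of $G_n$ becomes a Gaussian bump. -/

import Mathlib

open MeasureTheory ProbabilityTheory Filter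

noncomputable section

namespace HierGraph

/-- The length `|x ∧ y|` of the longest common prefix of two words of length `n`.
Letters are indexed by `0, …, n - 1`. -/
def prefixLength {N n : ℕ} (x y : Fin n → Fin N) : ℕ :=
  Nat.findGreatest (fun m => ∀ i : Fin n, (i : ℕ) < m → x i = y i) n

/-- The postfix of `x` that is left after deleting its first `m` letters consists of letters
of `V` only. -/
def PostfixIn {N n : ℕ} (V : Finset (Fin N)) (m : ℕ) (x : Fin n → Fin N) : Prop :=
  ∀ i : Fin n, m ≤ (i : ℕ) → x i ∈ V

/-- The edge relation of the deterministic hierarchical graph on words of length `n` generated by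
the base graph `G` with colour classes `V₁`, `V₂`. All loops are present; two different words are
joined iff after deleting the common prefix one postfix is of type 1, the other one is of type 2,
and all remaining coordinate pairs are edges of `G`. -/
def HierAdj {N : ℕ} (G : SimpleGraph (Fin N)) (V₁ V₂ : Finset (Fin N)) {n : ℕ}
    (x y : Fin n → Fin N) : Prop :=
  x = y ∨
    (((PostfixIn V₁ (prefixLength x y) x ∧ PostfixIn V₂ (prefixLength x y) y) ∨
        (PostfixIn V₂ (prefixLength x y) x ∧ PostfixIn V₁ (prefixLength x y) y)) ∧
      ∀ i : Fin n, prefixLength x y ≤ (i : ℕ) → G.Adj (x i) (y i))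

theorem prefixLength_comm {N n : ℕ} (x y : Fin n → Fin N) :
    prefixLength x y = prefixLength y x := by
  unfold prefixLength
  simp only [eq_comm]

theorem HierAdj.symm {N : ℕ} {G : SimpleGraph (Fin N)} {V₁ V₂ : Finset (Fin N)} {n : ℕ}
    {x y : Fin n → Fin N} (h : HierAdj G V₁ V₂ x y) : HierAdj G V₁ V₂ y x := by
  unfold HierAdj at h ⊢
  rw [prefixLength_comm y x]
  rcases h with h | ⟨h, h'⟩
  · exact Or.inl h.symm
  · refine Or.inr ⟨?_, fun i hi => (h' i hi).symm⟩
    rcases h with h | h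
    · exact Or.inr h.symm
    · exact Or.inl h.symm

/-- The word formed by the first `n` digits of the `N`-adic expansion of `a ∈ [0,1]`. -/
def code {N : ℕ} [NeZero N] (n : ℕ) (a : unitInterval) : Fin n → Fin N :=
  fun i => Real.digits (a : ℝ) N i

/-- The graph on the vertices `0, …, M` built from the points `X 0, …, X M` of `[0,1]`: two
different vertices are joined iff the first `n` digits of their points are joined in the
deterministic graph. (Points with the same first `n` digits are joined.) -/
def randomGraph {N : ℕ} [NeZero N] (G : SimpleGraph (Fin N)) (V₁ V₂ : Finset (Fin N))
    (n : ℕ) {M : ℕ} (X : Fin (M + 1) → unitInterval) : SimpleGraph (Fin (M + 1)) where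
  Adj i j := i ≠ j ∧ HierAdj G V₁ V₂ (code n (X i)) (code n (X j))
  symm := ⟨fun _ _ h => ⟨h.1.symm, h.2.symm⟩⟩
  loopless := ⟨fun _ h => h.1 rfl⟩

/-- The joint law of a uniformly chosen vertex `V` of `{0, …, M}` and, independently of it,
`M + 1` independent uniform points of `[0,1]`. -/
def sampleLaw (M : ℕ) : Measure (Fin (M + 1) × (Fin (M + 1) → unitInterval)) :=
  (PMF.uniformOfFintype (Fin (M + 1))).toMeasure.prod volume

open Classical in
/-- `P(deg V = u)` for a uniformly chosen vertex `V` of the random graph on `M + 1` vertices. -/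
def degreeProb {N : ℕ} [NeZero N] (G : SimpleGraph (Fin N)) (V₁ V₂ : Finset (Fin N))
    (n M u : ℕ) : ℝ :=
  (sampleLaw M).real {ω | (randomGraph G V₁ V₂ n ω.2).degree ω.1 = u}

/-- `t_k = 1 + d + ⋯ + d ^ k = (d ^ (k + 1) - 1) / (d - 1)`. -/
def urnDegree (d k : ℕ) : ℝ := ((d : ℝ) ^ (k + 1) - 1) / ((d : ℝ) - 1)

/-- `k₀(n) = max {(n + 1) log d₂ / log d₁, log n / log d₁}`. -/
def kZero (d₁ d₂ n : ℕ) : ℝ :=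
  max (((n : ℝ) + 1) * Real.log d₂ / Real.log d₁) (Real.log n / Real.log d₁)

/-- The interval `[m - K √m, m + K √m]`. -/
def window (K m : ℝ) : Set ℝ := Set.Icc (m - K * √m) (m + K * √m)

/-- The density `φ` of the standard normal law. -/
def stdNormalDensity (x : ℝ) : ℝ := gaussianPDFReal 0 1 x

end HierGraph

end

noncomputable section

namespace HierGraph

/-! Given the word x of the chosen vertex, each of the other M points is joined to it independently
with probability D(x)/Nⁿ, where D(x) counts the words joined to x, loop included. The degree law is
therefore a uniform mixture over words of binomial laws (`degreeProb_eq_sum`). The words ending in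
exactly k letters of V₁ have share (n₁/N)^k (n₂/N) and satisfy D = t_k. For k above k₀ every other
word has D ≤ d₁^k or D ≥ t_{k+1} (`closedDegree_trichotomy`), so its binomial mean differs from m =
c_n t_k by a factor at most d₁/(d₁+1) or at least 2. The first group gives the Gaussian bump, by a
local limit theorem with rate 1/√m (`binomialMass_eq_gaussian`, from Stirling's formula). The others
contribute at most exp(-am), by an exponential moment bound (`exists_binomialMass_le_exp_neg`). This
stays negligible after division by the share, which is at least N^{-(k+1)}: since k ≤ t_k and c_n →
∞, N^k ≤ exp(am/2) (`remainder_div_le`). Part (ii) only removes the factor 1/√(1 - t_k/Nⁿ) from the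
normalisation. -/

/-! ### Uniform law of the digit word -/

theorem measurable_code {N : ℕ} [NeZero N] (n : ℕ) : Measurable (code (N := N) n) := by
  refine measurable_pi_lambda _ fun i => ?_
  have h1 : Measurable fun a : unitInterval => ⌊(a : ℝ) * (N : ℝ) ^ ((i : ℕ) + 1)⌋₊ :=
    (measurable_subtype_coe.mul_const _).nat_floor
  exact (measurable_of_countable (Fin.ofNat N)).comp h1

/-- The partial digit sum locates a < 1 up to N⁻ⁿ; the endpoint 1, where that estimate is
unavailable, is a null set. -/
theorem volume_code_eq_le {N : ℕ} [NeZero N] (n : ℕ) (w : Fin n → Fin N) :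
    volume {a : unitInterval | code n a = w} ≤ ENNReal.ofReal (1 / (N : ℝ) ^ n) := by
  have key : ∃ s : ℝ, ∀ a : unitInterval, code n a = w → (a : ℝ) < 1 →
      (a : ℝ) ∈ Set.Icc s (s + 1 / (N : ℝ) ^ n) := by
    refine ⟨∑ i : Fin n, (w i : ℝ) * ((N : ℝ) ^ ((i : ℕ) + 1))⁻¹, fun a ha h1 => ?_⟩
    have hsum : ∑ i ∈ Finset.range n, Real.ofDigitsTerm (Real.digits (a : ℝ) N) i =
        ∑ i : Fin n, (w i : ℝ) * ((N : ℝ) ^ ((i : ℕ) + 1))⁻¹ := by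
      rw [Finset.sum_range, ← ha]
      rfl
    have hx : (a : ℝ) ∈ Set.Ico (0 : ℝ) 1 := ⟨a.2.1, h1⟩
    have h2 := Real.le_sum_ofDigitsTerm_digits (b := N) hx n
    have h3 := Real.sum_ofDigitsTerm_digits_le (b := N) hx n
    rw [hsum] at h2 h3
    rw [inv_pow] at h2
    rw [one_div]
    exact ⟨h3, by linarith⟩
  obtain ⟨s, hs⟩ := key
  have hsub : {a : unitInterval | code n a = w} ⊆
      (Subtype.val ⁻¹' (Set.Icc s (s + 1 / (N : ℝ) ^ n))) ∪ {1} := by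
    intro a ha
    by_cases h1 : a = 1
    · exact Or.inr h1
    · exact Or.inl (hs a ha (unitInterval.lt_one_iff_ne_one.mpr h1))
  calc volume {a : unitInterval | code n a = w}
      ≤ volume (Subtype.val ⁻¹' (Set.Icc s (s + 1 / (N : ℝ) ^ n)) : Set unitInterval)
          + volume ({1} : Set unitInterval) := (measure_mono hsub).trans (measure_union_le _ _)
    _ = volume (Subtype.val ⁻¹' (Set.Icc s (s + 1 / (N : ℝ) ^ n)) : Set unitInterval) := by
        simp
    _ ≤ volume (Set.Icc s (s + 1 / (N : ℝ) ^ n)) := by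
        rw [unitInterval.volume_apply]
        exact measure_mono (Set.image_preimage_subset _ _)
    _ = ENNReal.ofReal (1 / (N : ℝ) ^ n) := by rw [Real.volume_Icc]; simp

/-- Both the masses and their upper bounds N⁻ⁿ sum to 1 over all words, so every bound is attained;
no lower estimate is needed. -/
theorem volume_real_code_eq {N : ℕ} [NeZero N] (n : ℕ) (w : Fin n → Fin N) :
    volume.real {a : unitInterval | code n a = w} = 1 / (N : ℝ) ^ n := by
  have hN : (0 : ℝ) < N := by exact_mod_cast NeZero.pos N
  have hle : ∀ w : Fin n → Fin N,
      volume.real {a : unitInterval | code n a = w} ≤ 1 / (N : ℝ) ^ n := fun w =>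
    ENNReal.toReal_le_of_le_ofReal (by positivity) (volume_code_eq_le n w)
  have hsum : ∑ w : Fin n → Fin N, volume.real {a : unitInterval | code n a = w} =
      ∑ _w : Fin n → Fin N, 1 / (N : ℝ) ^ n := by
    have h1 := sum_measureReal_preimage_singleton (μ := (volume : Measure unitInterval))
      (f := code (N := N) n) Finset.univ
      (fun w _ => measurable_code n (measurableSet_singleton w))
    have h2 : ∑ _w : Fin n → Fin N, 1 / (N : ℝ) ^ n = 1 := by
      simp [hN.ne']
    rw [h2]
    simpa [Set.preimage] using h1
  exact (Finset.sum_eq_sum_iff_of_le fun w _ => hle w).mp hsum w (Finset.mem_univ w)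

theorem volume_real_code_mem {N : ℕ} [NeZero N] (n : ℕ) (S : Finset (Fin n → Fin N)) :
    volume.real {a : unitInterval | code n a ∈ S} = S.card / (N : ℝ) ^ n := by
  have h1 := sum_measureReal_preimage_singleton (μ := (volume : Measure unitInterval))
      (f := code (N := N) n) S (fun w _ => measurable_code n (measurableSet_singleton w))
  have h2 : ∀ w ∈ S, volume.real (code (N := N) n ⁻¹' {w}) = 1 / (N : ℝ) ^ n := fun w _ =>
    volume_real_code_eq n w
  rw [Finset.sum_congr rfl h2] at h1
  simp only [Finset.sum_const, nsmul_eq_mul, mul_one_div] at h1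
  rw [h1]
  rfl

/-! ### The degree law as a mixture of binomial laws -/

/-- The mass at `u` of the binomial law with parameters `M` and `p`. -/
def binomialMass (M u : ℕ) (p : ℝ) : ℝ := (M.choose u : ℝ) * p ^ u * (1 - p) ^ (M - u)

open Classical in
-- Fixing the word of v and the exact neighbour set cuts the event into boxes, whose product measure
-- can be computed factor by factor.
theorem setOf_card_neighbors_eq {Ω α ι : Type*} [Fintype ι] [DecidableEq ι] [Fintype α]
    (f : Ω → α) (R : α → α → Prop) (v : ι) (u : ℕ) :
    {X : ι → Ω | (Finset.univ.filter fun j => j ≠ v ∧ R (f (X v)) (f (X j))).card = u} =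
      ⋃ q ∈ (Finset.univ : Finset α) ×ˢ ((Finset.univ.erase v).powersetCard u),
        Set.univ.pi fun j => if j = v then f ⁻¹' {q.1} else
          if j ∈ q.2 then {a | R q.1 (f a)} else {a | R q.1 (f a)}ᶜ := by
  ext X
  simp only [Set.mem_ofPred_eq, Set.mem_iUnion, Finset.mem_product, Finset.mem_univ, true_and,
    Finset.mem_powersetCard, Set.mem_pi, exists_prop]
  constructor
  · intro h
    refine ⟨(f (X v), Finset.univ.filter fun j => j ≠ v ∧ R (f (X v)) (f (X j))), ⟨?_, h⟩, ?_⟩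
    · intro j hj
      simpa using (Finset.mem_filter.mp hj).2.1
    · intro j
      by_cases hj : j = v
      · subst hj; simp
      · by_cases hR : R (f (X v)) (f (X j)) <;> simp [hj, hR]
  · rintro ⟨⟨x, T⟩, ⟨hT, rfl⟩, h⟩
    have hx : f (X v) = x := by simpa using h v
    congr 1
    ext j
    have hj := h j
    by_cases hjv : j = v
    · subst hjv
      simpa using fun hm => absurd (hT hm) (by simp)
    · by_cases hm : j ∈ T <;> simp_all

open Classical in
theorem measureReal_pi_card_neighbors_eq {Ω α : Type*} [MeasurableSpace Ω] (μ : Measure Ω)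
    [IsProbabilityMeasure μ] [Fintype α] [MeasurableSpace α] [DiscreteMeasurableSpace α]
    {f : Ω → α} (hf : Measurable f) (R : α → α → Prop) {M : ℕ} (v : Fin (M + 1)) (u : ℕ) :
    MeasurableSet {X : Fin (M + 1) → Ω |
      (Finset.univ.filter fun j => j ≠ v ∧ R (f (X v)) (f (X j))).card = u} ∧
    (Measure.pi fun _ : Fin (M + 1) => μ).real {X : Fin (M + 1) → Ω |
      (Finset.univ.filter fun j => j ≠ v ∧ R (f (X v)) (f (X j))).card = u} =
      ∑ x, μ.real (f ⁻¹' {x}) * binomialMass M u (μ.real {a | R x (f a)}) := by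
  have hB : ∀ x, MeasurableSet {a | R x (f a)} := fun x => hf (MeasurableSet.of_discrete (s := {y | R x y}))
  have hA : ∀ x, MeasurableSet (f ⁻¹' {x}) := fun x => hf (MeasurableSet.of_discrete)
  rw [setOf_card_neighbors_eq]
  have hmeas : ∀ q ∈ (Finset.univ : Finset α) ×ˢ (((Finset.univ : Finset (Fin (M + 1))).erase v).powersetCard u),
      MeasurableSet (Set.univ.pi fun j => if j = v then f ⁻¹' {q.1} else
          if j ∈ q.2 then {a | R q.1 (f a)} else {a | R q.1 (f a)}ᶜ) := by
    intro q _
    refine MeasurableSet.univ_pi fun j => ?_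
    split_ifs
    · exact hA _
    · exact hB _
    · exact (hB _).compl
  refine ⟨Finset.measurableSet_biUnion _ hmeas, ?_⟩
  rw [measureReal_biUnion_finset _ hmeas, Finset.sum_product]
  · refine Finset.sum_congr rfl fun x _ => ?_
    have hterm : ∀ T ∈ ((Finset.univ : Finset (Fin (M + 1))).erase v).powersetCard u,
        (Measure.pi fun _ : Fin (M + 1) => μ).real (Set.univ.pi fun j => if j = v then f ⁻¹' {x} else
          if j ∈ T then {a | R x (f a)} else {a | R x (f a)}ᶜ) =
        μ.real (f ⁻¹' {x}) * (μ.real {a | R x (f a)} ^ u *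
          (1 - μ.real {a | R x (f a)}) ^ (M - u)) := by
      intro T hT
      obtain ⟨hT, hc⟩ := Finset.mem_powersetCard.mp hT
      rw [measureReal_def, Measure.pi_pi, ENNReal.toReal_prod,
        ← Finset.mul_prod_erase _ _ (Finset.mem_univ v)]
      simp only [if_true]
      have h1 : ∏ j ∈ Finset.univ.erase v, (μ (if j = v then f ⁻¹' {x} else
          if j ∈ T then {a | R x (f a)} else {a | R x (f a)}ᶜ)).toReal =
          ∏ j ∈ Finset.univ.erase v, if j ∈ T then μ.real {a | R x (f a)} else
            (1 - μ.real {a | R x (f a)}) := by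
        refine Finset.prod_congr rfl fun j hj => ?_
        rw [if_neg (Finset.ne_of_mem_erase hj)]
        split_ifs
        · rfl
        · exact probReal_compl_eq_one_sub (hB x)
      rw [h1, Finset.prod_ite, Finset.prod_const, Finset.prod_const, Finset.filter_mem_eq_inter,
        Finset.inter_eq_right.mpr hT, hc, Finset.filter_notMem_eq_sdiff,
        Finset.card_sdiff_of_subset hT, hc]
      simp [measureReal_def]
    rw [Finset.sum_congr rfl hterm, Finset.sum_const, Finset.card_powersetCard]
    simp only [Finset.card_erase_of_mem (Finset.mem_univ v), Finset.card_univ, Fintype.card_fin, nsmul_eq_mul,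
      binomialMass, Nat.add_sub_cancel]
    ring
  · rintro ⟨x, T⟩ hq ⟨x', T'⟩ hq' hne
    rw [Function.onFun, Set.disjoint_left]
    intro X hX hX'
    apply hne
    simp only [Set.mem_pi, Set.mem_univ, forall_const] at hX hX'
    simp only [Finset.coe_product, Set.mem_prod, Finset.mem_coe, Finset.mem_powersetCard] at hq hq'
    have hx : f (X v) = x := by simpa using hX v
    have hx' : f (X v) = x' := by simpa using hX' v
    obtain rfl : x = x' := hx.symm.trans hx'
    congr 1
    ext j
    by_cases hj : j = v
    · subst hj
      exact ⟨fun h => absurd (hq.2.1 h) (by simp), fun h => absurd (hq'.2.1 h) (by simp)⟩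
    · have h1 := hX j
      have h2 := hX' j
      by_cases hT : j ∈ T <;> by_cases hT' : j ∈ T' <;> simp_all

open Classical in
/-- The number of words joined to `x`, the loop at `x` included. -/
def closedDegree {N : ℕ} (G : SimpleGraph (Fin N)) (V₁ V₂ : Finset (Fin N)) {n : ℕ}
    (x : Fin n → Fin N) : ℕ :=
  (Finset.univ.filter fun y => HierAdj G V₁ V₂ x y).card

/-- The law for a fixed vertex v does not depend on v, so averaging over V changes nothing. The loop
is counted in `closedDegree` because distinct vertices with equal words are joined. -/
theorem degreeProb_eq_sum {N : ℕ} [NeZero N] (G : SimpleGraph (Fin N)) (V₁ V₂ : Finset (Fin N))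
    (n M u : ℕ) :
    degreeProb G V₁ V₂ n M u =
      ∑ x : Fin n → Fin N, 1 / (N : ℝ) ^ n *
        binomialMass M u (closedDegree G V₁ V₂ x / (N : ℝ) ^ n) := by
  classical
  unfold degreeProb sampleLaw
  set S : Fin (M + 1) → Set (Fin (M + 1) → unitInterval) := fun v => {X |
    (Finset.univ.filter fun j => j ≠ v ∧
      HierAdj G V₁ V₂ (code n (X v)) (code n (X j))).card = u} with hS
  have hset : {ω : Fin (M + 1) × (Fin (M + 1) → unitInterval) |
      (randomGraph G V₁ V₂ n ω.2).degree ω.1 = u} = {ω | ω.2 ∈ S ω.1} := by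
    ext ω
    simp only [Set.mem_ofPred_eq, hS, ← SimpleGraph.card_neighborFinset_eq_degree]
    rw [show (randomGraph G V₁ V₂ n ω.2).neighborFinset ω.1 = Finset.univ.filter fun j => j ≠ ω.1 ∧
      HierAdj G V₁ V₂ (code n (ω.2 ω.1)) (code n (ω.2 j)) from ?_]
    ext j
    rw [SimpleGraph.mem_neighborFinset]
    simp [randomGraph, ne_comm]
  have hv := fun v : Fin (M + 1) => measureReal_pi_card_neighbors_eq
    (volume : Measure unitInterval) (measurable_code (N := N) n) (HierAdj G V₁ V₂) v u
  have hmeas : MeasurableSet {ω : Fin (M + 1) × (Fin (M + 1) → unitInterval) | ω.2 ∈ S ω.1} := by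
    have : {ω : Fin (M + 1) × (Fin (M + 1) → unitInterval) | ω.2 ∈ S ω.1} =
        ⋃ v, {v} ×ˢ S v := by
      ext ⟨v, X⟩
      simp
    rw [this]
    exact MeasurableSet.iUnion fun v => (measurableSet_singleton v).prod (hv v).1
  have hval : ∀ v, volume (S v) = ENNReal.ofReal (∑ x : Fin n → Fin N, 1 / (N : ℝ) ^ n *
        binomialMass M u (closedDegree G V₁ V₂ x / (N : ℝ) ^ n)) := by
    intro v
    rw [← ofReal_measureReal (measure_ne_top _ _), volume_pi, (hv v).2]
    congr 1
    refine Finset.sum_congr rfl fun x _ => ?_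
    rw [show code (N := N) n ⁻¹' {x} = {a | code n a = x} from rfl, volume_real_code_eq,
      closedDegree, ← volume_real_code_mem]
    simp
  have hnn : 0 ≤ ∑ x : Fin n → Fin N, 1 / (N : ℝ) ^ n *
        binomialMass M u (closedDegree G V₁ V₂ x / (N : ℝ) ^ n) := by
    have h0 := (hv 0).2
    have : ∀ x : Fin n → Fin N, volume.real (code (N := N) n ⁻¹' {x}) *
        binomialMass M u (volume.real {a | HierAdj G V₁ V₂ x (code n a)}) = 1 / (N : ℝ) ^ n *
        binomialMass M u (closedDegree G V₁ V₂ x / (N : ℝ) ^ n) := by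
      intro x
      rw [show code (N := N) n ⁻¹' {x} = {a | code n a = x} from rfl, volume_real_code_eq,
        closedDegree, ← volume_real_code_mem]
      simp
    simp only [this] at h0
    rw [← h0]
    exact measureReal_nonneg
  rw [hset, measureReal_def, Measure.prod_apply hmeas]
  simp only [Set.preimage_ofPred_eq, Set.ofPred_mem_eq, hval]
  rw [lintegral_const]
  rw [measure_univ, mul_one, ENNReal.toReal_ofReal hnn]

/-! ### Closed degrees of words in the deterministic graph -/

theorem eq_of_lt_prefixLength {N n : ℕ} (x y : Fin n → Fin N) (i : Fin n)
    (hi : (i : ℕ) < prefixLength x y) : x i = y i :=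
  Nat.findGreatest_spec (P := fun m => ∀ i : Fin n, (i : ℕ) < m → x i = y i) (Nat.zero_le n)
    (fun _ h => absurd h (Nat.not_lt_zero _)) i hi

theorem prefixLength_lt {N n : ℕ} {x y : Fin n → Fin N} (h : x ≠ y) : prefixLength x y < n := by
  by_contra! hn
  exact h (funext fun i => eq_of_lt_prefixLength x y i (i.2.trans_le hn))

theorem prefixLength_eq_of {N n : ℕ} {x y : Fin n → Fin N} {p : ℕ} (hp : p < n)
    (h : ∀ i : Fin n, (i : ℕ) < p → x i = y i) (hne : x ⟨p, hp⟩ ≠ y ⟨p, hp⟩) :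
    prefixLength x y = p := by
  unfold prefixLength
  rw [Nat.findGreatest_eq_iff]
  exact ⟨hp.le, fun _ => h, fun m hm _ hm' => hne (hm' ⟨p, hp⟩ hm)⟩

/-- The words that share the first `p` letters with `x` and are joined to `x` by an edge of `G`
in each remaining coordinate. -/
def levelNeighbors {N n : ℕ} (G : SimpleGraph (Fin N)) [DecidableRel G.Adj] (x : Fin n → Fin N)
    (p : ℕ) : Finset (Fin n → Fin N) :=
  Fintype.piFinset fun i => if (i : ℕ) < p then {x i} else G.neighborFinset (x i)

theorem mem_levelNeighbors {N n : ℕ} {G : SimpleGraph (Fin N)} [DecidableRel G.Adj]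
    {x y : Fin n → Fin N} {p : ℕ} :
    y ∈ levelNeighbors G x p ↔
      (∀ i : Fin n, (i : ℕ) < p → x i = y i) ∧ ∀ i : Fin n, p ≤ (i : ℕ) → G.Adj (x i) (y i) := by
  rw [levelNeighbors, Fintype.mem_piFinset, ← forall_and]
  refine forall_congr' fun i => ?_
  by_cases h : (i : ℕ) < p
  · simp [h, eq_comm]
  · simp [h, not_lt.mp h]

theorem prefixLength_of_mem_levelNeighbors {N n : ℕ} {G : SimpleGraph (Fin N)}
    [DecidableRel G.Adj] {x y : Fin n → Fin N} {p : ℕ} (hp : p < n)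
    (h : y ∈ levelNeighbors G x p) : prefixLength x y = p :=
  prefixLength_eq_of hp (mem_levelNeighbors.mp h).1 ((mem_levelNeighbors.mp h).2 ⟨p, hp⟩ le_rfl).ne

theorem card_levelNeighbors {N n : ℕ} (G : SimpleGraph (Fin N)) [DecidableRel G.Adj]
    (x : Fin n → Fin N) (p : ℕ) :
    (levelNeighbors G x p).card = ∏ i : Fin n, if (i : ℕ) < p then 1 else G.degree (x i) := by
  rw [levelNeighbors, Fintype.card_piFinset]
  refine Finset.prod_congr rfl fun i _ => ?_
  split_ifs <;> simp

section

variable {N : ℕ} {G : SimpleGraph (Fin N)} {V₁ V₂ : Finset (Fin N)}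

theorem postfixIn_right_of_adj {n : ℕ}
    (hG : G.IsBipartiteWith (V₁ : Set (Fin N)) (V₂ : Set (Fin N)))
    {x y : Fin n → Fin N} {p : ℕ} (h : ∀ i : Fin n, p ≤ (i : ℕ) → G.Adj (x i) (y i)) :
    (PostfixIn V₁ p x → PostfixIn V₂ p y) ∧ (PostfixIn V₂ p x → PostfixIn V₁ p y) :=
  ⟨fun hx i hi => hG.mem_of_mem_adj (hx i hi) (h i hi),
    fun hx i hi => hG.symm.mem_of_mem_adj (hx i hi) (h i hi)⟩

open Classical in
-- Neighbours are sorted by the common prefix length p. Edges of G swap the classes, so only the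
-- type of the postfix of x has to be checked; the summand 1 is the loop.
theorem closedDegree_eq [DecidableRel G.Adj]
    (hG : G.IsBipartiteWith (V₁ : Set (Fin N)) (V₂ : Set (Fin N)))
    {n : ℕ} (x : Fin n → Fin N) :
    closedDegree G V₁ V₂ x = 1 +
      ∑ p ∈ Finset.range n with PostfixIn V₁ p x ∨ PostfixIn V₂ p x,
        ∏ i : Fin n, if (i : ℕ) < p then 1 else G.degree (x i) := by
  have hset : (Finset.univ.filter fun y => HierAdj G V₁ V₂ x y) = insert x
      (((Finset.range n).filter fun p => PostfixIn V₁ p x ∨ PostfixIn V₂ p x).biUnion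
        fun p => levelNeighbors G x p) := by
    ext y
    simp only [Finset.mem_filter, Finset.mem_univ, true_and, Finset.mem_insert,
      Finset.mem_biUnion, Finset.mem_range]
    constructor
    · intro h
      by_cases hxy : x = y
      · exact Or.inl hxy.symm
      · rcases h with h | ⟨h, hadj⟩
        · exact absurd h hxy
        · refine Or.inr ⟨prefixLength x y, ⟨prefixLength_lt hxy, ?_⟩, ?_⟩
          · exact h.imp And.left And.left
          · exact mem_levelNeighbors.mpr ⟨fun i hi => eq_of_lt_prefixLength x y i hi, hadj⟩
    · rintro (rfl | ⟨p, ⟨hp, hm⟩, hy⟩)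
      · exact Or.inl rfl
      · have hadj := (mem_levelNeighbors.mp hy).2
        refine Or.inr ?_
        rw [prefixLength_of_mem_levelNeighbors hp hy]
        have := postfixIn_right_of_adj hG hadj
        exact ⟨hm.imp (fun h => ⟨h, this.1 h⟩) (fun h => ⟨h, this.2 h⟩), hadj⟩
  rw [closedDegree, hset, Finset.card_insert_of_notMem, add_comm, Finset.card_biUnion]
  · simp only [card_levelNeighbors]
  · intro p hp q hq hpq
    rw [Function.onFun, Finset.disjoint_left]
    intro y hy hy'
    simp only [Finset.coe_filter, Set.mem_ofPred_eq, Finset.mem_range] at hp hq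
    exact hpq ((prefixLength_of_mem_levelNeighbors hp.1 hy).symm.trans
      (prefixLength_of_mem_levelNeighbors hq.1 hy'))
  · simp only [Finset.mem_biUnion, Finset.mem_filter, Finset.mem_range, not_exists, not_and]
    intro p hp hx
    exact ((mem_levelNeighbors.mp hx).2 ⟨p, hp.1⟩ le_rfl).ne rfl

theorem prod_ite_lt_const {n p : ℕ} (hp : p ≤ n) (d : ℕ) :
    (∏ i : Fin n, if (i : ℕ) < p then 1 else d) = d ^ (n - p) := by
  rw [Fin.prod_univ_eq_prod_range (fun i => if i < p then 1 else d) n]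
  obtain ⟨q, rfl⟩ := Nat.exists_eq_add_of_le hp
  rw [Finset.prod_range_add, Finset.prod_eq_one fun i hi => if_pos (Finset.mem_range.mp hi)]
  simp

theorem one_add_sum_Ico_pow {n k : ℕ} (hk : k ≤ n) (d : ℕ) :
    1 + ∑ p ∈ Finset.Ico (n - k) n, d ^ (n - p) = ∑ j ∈ Finset.range (k + 1), d ^ j := by
  induction k with
  | zero => simp
  | succ k ih =>
    rw [Finset.sum_range_succ, ← ih (by omega), Finset.sum_eq_sum_Ico_succ_bot (by omega),
      show n - (k + 1) + 1 = n - k by omega, show n - (n - (k + 1)) = k + 1 by omega]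
    ring

theorem prod_degree_eq [DecidableRel G.Adj] {d₁ n p : ℕ} (hd₁ : ∀ x ∈ V₁, G.degree x = d₁)
    (hp : p ≤ n) {x : Fin n → Fin N} (hx : PostfixIn V₁ p x) :
    (∏ i : Fin n, if (i : ℕ) < p then 1 else G.degree (x i)) = d₁ ^ (n - p) := by
  rw [← prod_ite_lt_const hp]
  refine Finset.prod_congr rfl fun i _ => ?_
  split_ifs with h
  · rfl
  · exact hd₁ _ (hx i (not_lt.mp h))

theorem prod_degree_le [DecidableRel G.Adj] {d₂ n p : ℕ} (hd₂ : ∀ x ∈ V₂, G.degree x ≤ d₂)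
    (hp : p ≤ n) {x : Fin n → Fin N} (hx : PostfixIn V₂ p x) :
    (∏ i : Fin n, if (i : ℕ) < p then 1 else G.degree (x i)) ≤ d₂ ^ (n - p) := by
  rw [← prod_ite_lt_const hp]
  refine Finset.prod_le_prod' fun i _ => ?_
  split_ifs with h
  · rfl
  · exact hd₂ _ (hx i (not_lt.mp h))

theorem PostfixIn.mono {n p q : ℕ} {V : Finset (Fin N)} {x : Fin n → Fin N} (hpq : p ≤ q)
    (h : PostfixIn V p x) : PostfixIn V q x := fun i hi => h i (hpq.trans hi)

/-- The letter of V₂ before the run stops longer postfixes from being of type 1, and the last letter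
stops them from being of type 2. Exactly the levels n-k ≤ p < n remain. -/
theorem closedDegree_eq_of_run [DecidableRel G.Adj] (hV : IsCompl V₁ V₂)
    (hG : G.IsBipartiteWith (V₁ : Set (Fin N)) (V₂ : Set (Fin N))) {d₁ n k : ℕ}
    (hd₁ : ∀ x ∈ V₁, G.degree x = d₁) (hk : 0 < k) (hkn : k < n) {x : Fin n → Fin N}
    (h1 : PostfixIn V₁ (n - k) x) (h2 : x ⟨n - k - 1, by omega⟩ ∈ V₂) :
    closedDegree G V₁ V₂ x = ∑ j ∈ Finset.range (k + 1), d₁ ^ j := by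
  classical
  have hdisj : ∀ {a}, a ∈ V₁ → a ∉ V₂ := fun h h' => Finset.disjoint_left.mp hV.disjoint h h'
  rw [closedDegree_eq hG, ← one_add_sum_Ico_pow hkn.le]
  congr 1
  have hset : ((Finset.range n).filter fun p => PostfixIn V₁ p x ∨ PostfixIn V₂ p x) =
      Finset.Ico (n - k) n := by
    ext p
    simp only [Finset.mem_filter, Finset.mem_range, Finset.mem_Ico]
    constructor
    · rintro ⟨hp, h⟩
      refine ⟨?_, hp⟩
      by_contra! hlt
      rcases h with h | h
      · exact hdisj (h ⟨n - k - 1, by omega⟩ (by simp; omega)) h2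
      · exact hdisj (h1 ⟨n - 1, by omega⟩ (by simp; omega)) (h _ (by simp; omega))
    · rintro ⟨hp, hp'⟩
      exact ⟨hp', Or.inl (h1.mono hp)⟩
  rw [hset]
  refine Finset.sum_congr rfl fun p hp => ?_
  rw [Finset.mem_Ico] at hp
  exact prod_degree_eq hd₁ hp.2.le (h1.mono hp.1)

theorem le_closedDegree_of_run [DecidableRel G.Adj]
    (hG : G.IsBipartiteWith (V₁ : Set (Fin N)) (V₂ : Set (Fin N))) {d₁ n k : ℕ}
    (hd₁ : ∀ x ∈ V₁, G.degree x = d₁) (hkn : k ≤ n) {x : Fin n → Fin N}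
    (h1 : PostfixIn V₁ (n - k) x) :
    ∑ j ∈ Finset.range (k + 1), d₁ ^ j ≤ closedDegree G V₁ V₂ x := by
  classical
  rw [closedDegree_eq hG, ← one_add_sum_Ico_pow hkn]
  gcongr 1 + ?_
  calc ∑ p ∈ Finset.Ico (n - k) n, d₁ ^ (n - p)
      = ∑ p ∈ Finset.Ico (n - k) n, ∏ i : Fin n, (if (i : ℕ) < p then 1 else G.degree (x i)) := by
        refine Finset.sum_congr rfl fun p hp => ?_
        rw [Finset.mem_Ico] at hp
        exact (prod_degree_eq hd₁ hp.2.le (h1.mono hp.1)).symm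
    _ ≤ _ := by
        refine Finset.sum_le_sum_of_subset fun p hp => ?_
        rw [Finset.mem_Ico] at hp
        exact Finset.mem_filter.mpr ⟨Finset.mem_range.mpr hp.2, Or.inl (h1.mono hp.1)⟩

theorem closedDegree_le_of_last_mem_right [DecidableRel G.Adj] (hV : IsCompl V₁ V₂)
    (hG : G.IsBipartiteWith (V₁ : Set (Fin N)) (V₂ : Set (Fin N))) {d₂ n : ℕ}
    (hd₂ : ∀ x ∈ V₂, G.degree x ≤ d₂) (hn : 0 < n) {x : Fin n → Fin N}
    (h2 : x ⟨n - 1, by omega⟩ ∈ V₂) :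
    closedDegree G V₁ V₂ x ≤ ∑ j ∈ Finset.range (n + 1), d₂ ^ j := by
  classical
  have hdisj : ∀ {a}, a ∈ V₁ → a ∉ V₂ := fun h h' => Finset.disjoint_left.mp hV.disjoint h h'
  rw [closedDegree_eq hG, ← one_add_sum_Ico_pow le_rfl]
  gcongr 1 + ?_
  rw [Nat.sub_self, ← Finset.range_eq_Ico]
  refine (Finset.sum_le_sum fun p hp => ?_).trans
    (Finset.sum_le_sum_of_subset (Finset.filter_subset _ _))
  simp only [Finset.mem_filter, Finset.mem_range] at hp
  rcases hp with ⟨hp, h | h⟩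
  · exact absurd h2 (hdisj (h _ (by simp; omega)))
  · exact prod_degree_le hd₂ hp.le h

theorem closedDegree_le_of_last_mem_left [DecidableRel G.Adj] (hV : IsCompl V₁ V₂)
    (hG : G.IsBipartiteWith (V₁ : Set (Fin N)) (V₂ : Set (Fin N))) {d₁ n k : ℕ}
    (hd₁ : ∀ x ∈ V₁, G.degree x = d₁) (hk : 0 < k) (hkn : k < n) {x : Fin n → Fin N}
    (h1 : x ⟨n - 1, by omega⟩ ∈ V₁) (h2 : ¬ PostfixIn V₁ (n - k) x) :
    closedDegree G V₁ V₂ x ≤ ∑ j ∈ Finset.range k, d₁ ^ j := by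
  classical
  have hdisj : ∀ {a}, a ∈ V₁ → a ∉ V₂ := fun h h' => Finset.disjoint_left.mp hV.disjoint h h'
  have hpost : ∀ p < n, PostfixIn V₁ p x ∨ PostfixIn V₂ p x → PostfixIn V₁ p x := by
    rintro p hp (h | h)
    · exact h
    · exact absurd (h ⟨n - 1, by omega⟩ (by simp; omega)) (hdisj h1)
  -- A run shorter than k allows at most k-1 levels, which together with the loop give k powers of
  -- d₁.
  obtain ⟨k, rfl⟩ : ∃ j, k = j + 1 := ⟨k - 1, by omega⟩
  rw [closedDegree_eq hG, ← one_add_sum_Ico_pow (by omega : k ≤ n)]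
  gcongr 1 + ?_
  calc _ = ∑ p ∈ Finset.range n with PostfixIn V₁ p x ∨ PostfixIn V₂ p x, d₁ ^ (n - p) := by
        refine Finset.sum_congr rfl fun p hp => ?_
        simp only [Finset.mem_filter, Finset.mem_range] at hp
        exact prod_degree_eq hd₁ hp.1.le (hpost p hp.1 hp.2)
    _ ≤ _ := by
        refine Finset.sum_le_sum_of_subset fun p hp => ?_
        simp only [Finset.mem_filter, Finset.mem_range] at hp
        rw [Finset.mem_Ico]
        refine ⟨?_, hp.1⟩
        by_contra! hlt
        exact h2 ((hpost p hp.1 hp.2).mono (by omega))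

/-! ### Words with a run of length k, and the gap around t_k -/

/-- The words in which the last `k` letters belong to `V₁` and the preceding one to `V₂`. -/
def runWords (V₁ V₂ : Finset (Fin N)) (n k : ℕ) : Finset (Fin n → Fin N) :=
  Fintype.piFinset fun i =>
    if (i : ℕ) < n - k - 1 then Finset.univ else if (i : ℕ) = n - k - 1 then V₂ else V₁

theorem card_runWords (V₁ V₂ : Finset (Fin N)) {n k : ℕ} (hkn : k < n) :
    (runWords V₁ V₂ n k).card = N ^ (n - k - 1) * V₂.card * V₁.card ^ k := by
  obtain ⟨a, rfl⟩ : ∃ a, n = a + 1 + k := ⟨n - k - 1, by omega⟩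
  have ha : a + 1 + k - k - 1 = a := by omega
  rw [runWords, Fintype.card_piFinset, ha]
  have : ∀ i : Fin (a + 1 + k), (if (i : ℕ) < a then Finset.univ else
      if (i : ℕ) = a then V₂ else V₁).card =
      (fun i : ℕ => if i < a then N else if i = a then V₂.card else V₁.card) i := by
    intro i
    simp only
    split_ifs <;> simp
  rw [Finset.prod_congr rfl fun i _ => this i, Fin.prod_univ_eq_prod_range
    (fun i : ℕ => if i < a then N else if i = a then V₂.card else V₁.card), Finset.prod_range_add,
    Finset.prod_range_succ]
  congr 1
  · congr 1
    · rw [Finset.prod_congr rfl (g := fun _ => N)]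
      · simp
      · intro i hi
        simp [Finset.mem_range.mp hi]
    · simp
  · rw [Finset.prod_congr rfl (g := fun _ => V₁.card)]
    · simp
    · intro i _
      rw [if_neg (by omega), if_neg (by omega)]

theorem mem_runWords {n k : ℕ} (hkn : k < n) {x : Fin n → Fin N} :
    x ∈ runWords V₁ V₂ n k ↔ PostfixIn V₁ (n - k) x ∧ x ⟨n - k - 1, by omega⟩ ∈ V₂ := by
  rw [runWords, Fintype.mem_piFinset]
  constructor
  · intro h
    refine ⟨fun i hi => ?_, by simpa using h ⟨n - k - 1, by omega⟩⟩
    have := h i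
    rwa [if_neg (by omega), if_neg (by omega)] at this
  · rintro ⟨h1, h2⟩ i
    split_ifs with hi hi'
    · exact Finset.mem_univ _
    · rwa [show i = ⟨n - k - 1, by omega⟩ from Fin.ext hi']
    · exact h1 i (by omega)

theorem one_le_of_degree [DecidableRel G.Adj] (hV₁ : V₁.Nonempty)
    (hG : G.IsBipartiteWith (V₁ : Set (Fin N)) (V₂ : Set (Fin N))) {d₁ d₂ : ℕ}
    (hd₁ : ∀ x ∈ V₁, G.degree x = d₁) (hd₂ : ∀ x ∈ V₂, G.degree x ≤ d₂) (hd : d₂ + 1 ≤ d₁) :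
    1 ≤ d₂ := by
  obtain ⟨x, hx⟩ := hV₁
  have hpos : 0 < G.degree x := by rw [hd₁ x hx]; omega
  obtain ⟨y, hy⟩ := (G.degree_pos_iff_exists_adj x).mp hpos
  have hy2 : y ∈ V₂ := hG.mem_of_mem_adj hx hy
  exact ((G.degree_pos_iff_exists_adj y).mpr ⟨x, hy.symm⟩).trans_le (hd₂ y hy2)

theorem degree_lt_card [DecidableRel G.Adj] (hV₁ : V₁.Nonempty) {d₁ : ℕ}
    (hd₁ : ∀ x ∈ V₁, G.degree x = d₁) : d₁ < N := by
  obtain ⟨x, hx⟩ := hV₁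
  simpa [hd₁ x hx] using G.degree_lt_card_verts x

/-- This is the role of k₀: words ending in V₂ stay below d₁^k. The first entry of the maximum
serves d₂ ≥ 2; for d₂ = 1 it vanishes, the sum is n+1, and the second entry gives n < d₁^k. -/
theorem geom_sum_le_of_kZero_lt {d₁ d₂ n k : ℕ} (hn : 0 < n) (h2 : 1 ≤ d₂) (hd : d₂ + 1 ≤ d₁)
    (hk : kZero d₁ d₂ n < k) : ∑ j ∈ Finset.range (n + 1), d₂ ^ j ≤ d₁ ^ k := by
  have hlog : 0 < Real.log d₁ := Real.log_pos (by exact_mod_cast (by omega : 1 < d₁))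
  obtain ⟨ha, hb⟩ := max_lt_iff.mp hk
  rw [div_lt_iff₀ hlog] at ha hb
  have hd1 : (0 : ℝ) < d₁ := by exact_mod_cast (by omega : 0 < d₁)
  rcases h2.eq_or_lt with rfl | h2
  · have : (n : ℝ) < (d₁ : ℝ) ^ k := by
      rw [← Real.log_lt_log_iff (by exact_mod_cast hn) (by positivity), Real.log_pow]
      exact hb
    have : n < d₁ ^ k := by exact_mod_cast this
    simpa using this
  · have : (d₂ : ℝ) ^ (n + 1) < (d₁ : ℝ) ^ k := by
      rw [← Real.log_lt_log_iff (by positivity) (by positivity), Real.log_pow, Real.log_pow]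
      exact_mod_cast ha
    have : d₂ ^ (n + 1) < d₁ ^ k := by exact_mod_cast this
    exact (Nat.geomSum_lt h2 fun j hj => Finset.mem_range.mp hj).le.trans this.le

/-- Outside the run words, either the last letter is in V₂, or the final run of V₁ is shorter than
k, or it has length at least k+1. -/
theorem closedDegree_trichotomy [DecidableRel G.Adj] (hV₁ : V₁.Nonempty) (hV : IsCompl V₁ V₂)
    (hG : G.IsBipartiteWith (V₁ : Set (Fin N)) (V₂ : Set (Fin N))) {d₁ d₂ n k : ℕ}
    (hd₁ : ∀ x ∈ V₁, G.degree x = d₁) (hd₂ : ∀ x ∈ V₂, G.degree x ≤ d₂) (hd : d₂ + 1 ≤ d₁)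
    (hk0 : kZero d₁ d₂ n < k) (hk : 0 < k) (hkn : k < n) (x : Fin n → Fin N) :
    (x ∈ runWords V₁ V₂ n k → closedDegree G V₁ V₂ x = ∑ j ∈ Finset.range (k + 1), d₁ ^ j) ∧
    (x ∉ runWords V₁ V₂ n k → closedDegree G V₁ V₂ x ≤ d₁ ^ k ∨
      ∑ j ∈ Finset.range (k + 2), d₁ ^ j ≤ closedDegree G V₁ V₂ x) := by
  have h2 := one_le_of_degree hV₁ hG hd₁ hd₂ hd
  have hmem : ∀ a, a ∈ V₁ ∨ a ∈ V₂ := fun a => by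
    have := Finset.mem_univ a
    rw [← Finset.top_eq_univ, ← hV.sup_eq_top] at this
    exact Finset.mem_union.mp this
  refine ⟨fun hx => ?_, fun hx => ?_⟩
  · obtain ⟨ha, hb⟩ := (mem_runWords hkn).mp hx
    exact closedDegree_eq_of_run hV hG hd₁ hk hkn ha hb
  · rcases hmem (x ⟨n - 1, by omega⟩) with hl | hl
    · by_cases hp : PostfixIn V₁ (n - k) x
      · right
        refine le_closedDegree_of_run hG hd₁ (by omega) (fun i hi => ?_)
        rcases eq_or_lt_of_le hi with hi | hi
        · rcases hmem (x i) with h | h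
          · exact h
          · exact absurd ((mem_runWords hkn).mpr ⟨hp, by
              rwa [show i = ⟨n - k - 1, by omega⟩ from Fin.ext (by simp; omega)] at h⟩) hx
        · exact hp i (by omega)
      · left
        exact (closedDegree_le_of_last_mem_left hV hG hd₁ hk hkn hl hp).trans
          (Nat.geomSum_lt (by omega) fun j hj => Finset.mem_range.mp hj).le
    · left
      exact (closedDegree_le_of_last_mem_right hV hG hd₂ (by omega) hl).trans
        (geom_sum_le_of_kZero_lt (by omega) h2 hd hk0)

end

/-! ### Stirling's formula and the local limit theorem -/

theorem urnDegree_eq_geom_sum {d : ℕ} (hd : 2 ≤ d) (k : ℕ) :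
    urnDegree d k = ((∑ j ∈ Finset.range (k + 1), d ^ j : ℕ) : ℝ) := by
  have : (d : ℝ) ≠ 1 := by exact_mod_cast (by omega : d ≠ 1)
  push_cast
  rw [geom_sum_eq this, urnDegree]

/-- The increments telescope: log of the Stirling sequence minus 1/(12n) is nondecreasing, and its
limit is log √π. -/
theorem log_stirlingSeq_le (n : ℕ) (hn : n ≠ 0) :
    Real.log (Stirling.stirlingSeq n) ≤ Real.log √Real.pi + 1 / (12 * n) := by
  have hstep : ∀ k : ℕ, Real.log (Stirling.stirlingSeq n) - 1 / (12 * n) ≤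
      Real.log (Stirling.stirlingSeq (k + n)) - 1 / (12 * ((k + n : ℕ) : ℝ)) := by
    intro k
    induction k with
    | zero => simp
    | succ k ih =>
      have h := Stirling.log_stirlingSeq_sdiff_le (k + n)
      have hpos : (0 : ℝ) < ((k + n : ℕ) : ℝ) := by exact_mod_cast (by omega : 0 < k + n)
      have he : 1 / (12 * ((k + n : ℕ) : ℝ) * (((k + n : ℕ) : ℝ) + 1)) =
          1 / (12 * ((k + n : ℕ) : ℝ)) - 1 / (12 * (((k + n : ℕ) : ℝ) + 1)) := by
        field_simp
        ring
      rw [he] at h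
      rw [show k + 1 + n = k + n + 1 by omega, Nat.cast_add_one]
      linarith
  have hlim : Tendsto (fun k : ℕ => Real.log (Stirling.stirlingSeq (k + n))) atTop
      (nhds (Real.log √Real.pi)) := by
    have h := Stirling.tendsto_stirlingSeq_sqrt_pi.log
      (Real.sqrt_ne_zero'.mpr Real.pi_pos)
    exact h.comp (tendsto_add_atTop_nat n)
  have := ge_of_tendsto' hlim fun k => (hstep k).trans
    (sub_le_self _ (by positivity : (0 : ℝ) ≤ 1 / (12 * ((k + n : ℕ) : ℝ))))
  linarith

/-- Stirling's formula with an explicit remainder. -/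
theorem exists_log_factorial_eq {n : ℕ} (hn : n ≠ 0) :
    ∃ r : ℝ, 0 ≤ r ∧ r ≤ 1 / (12 * n) ∧
      Real.log (n.factorial) = n * Real.log n - n + Real.log n / 2 +
        Real.log (2 * Real.pi) / 2 + r := by
  refine ⟨Real.log (n.factorial) - (n * Real.log n - n + Real.log n / 2 +
        Real.log (2 * Real.pi) / 2), ?_, ?_, by ring⟩
  · have := Stirling.le_log_factorial_stirling hn
    linarith
  · have h := log_stirlingSeq_le n hn
    have hn' : (n : ℝ) ≠ 0 := by exact_mod_cast hn
    rw [Stirling.log_stirlingSeq_formula, Real.log_sqrt Real.pi_pos.le,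
      Real.log_mul two_ne_zero hn', Real.log_div hn' (Real.exp_ne_zero _), Real.log_exp] at h
    rw [Real.log_mul two_ne_zero Real.pi_ne_zero]
    linarith

theorem abs_log_one_add_le {y : ℝ} (hy : |y| ≤ 1 / 2) : |Real.log (1 + y)| ≤ 2 * |y| := by
  have h := Real.abs_log_sub_add_sum_range_le (x := -y) (by rw [abs_neg]; linarith) 0
  simp only [Finset.range_zero, Finset.sum_empty, zero_add, sub_neg_eq_add, abs_neg, pow_one] at h
  refine h.trans ?_
  rw [div_le_iff₀ (by linarith)]
  nlinarith [abs_nonneg y]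

theorem abs_one_add_mul_log_sub_le {y : ℝ} (hy : |y| ≤ 1 / 2) :
    |(1 + y) * Real.log (1 + y) - (y + y ^ 2 / 2)| ≤ 4 * |y| ^ 3 := by
  have h := Real.abs_log_sub_add_sum_range_le (x := -y) (by rw [abs_neg]; linarith) 2
  simp only [Finset.sum_range_succ, Finset.range_zero, Finset.sum_empty, zero_add, sub_neg_eq_add,
    abs_neg] at h
  norm_num at h
  have h0 := abs_nonneg y
  have h1 : |-y + y ^ 2 / 2 + Real.log (1 + y)| ≤ 2 * |y| ^ 3 := by
    refine h.trans ?_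
    rw [div_le_iff₀ (by linarith)]
    nlinarith [pow_nonneg h0 3]
  have h2 : (1 + y) * Real.log (1 + y) - (y + y ^ 2 / 2) =
      (1 + y) * (-y + y ^ 2 / 2 + Real.log (1 + y)) + -(y ^ 3 / 2) := by ring
  have h3 : |1 + y| ≤ 3 / 2 := (abs_add_le _ _).trans (by rw [abs_one]; linarith)
  calc _ ≤ |1 + y| * |-y + y ^ 2 / 2 + Real.log (1 + y)| + |y| ^ 3 / 2 := by
        rw [h2]
        refine (abs_add_le _ _).trans_eq ?_
        rw [abs_mul, abs_neg, abs_div, abs_pow, abs_two]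
    _ ≤ 3 / 2 * (2 * |y| ^ 3) + |y| ^ 3 / 2 := by gcongr
    _ ≤ 4 * |y| ^ 3 := by nlinarith [pow_nonneg h0 3]

/-- Stirling's formula for all three factorials. Here m and W are the expected numbers of successes
and failures, and y and -z the relative deviations from them. -/
theorem log_binomialMass_eq {M u : ℕ} {p m W y z : ℝ} (hp0 : 0 < p) (hp1 : p < 1) (hu : 0 < u)
    (huM : u < M) (hm : m = M * p) (hW : W = M * (1 - p)) (hy : (u : ℝ) = m * (1 + y))
    (hz : (M : ℝ) - u = W * (1 - z)) :
    ∃ r : ℝ, |r| ≤ 1 / (12 * M) + 1 / (12 * u) + 1 / (12 * (M - u)) ∧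
      Real.log (binomialMass M u p) = -(Real.log (2 * Real.pi) / 2) -
        Real.log (m * (1 - p)) / 2 - m * ((1 + y) * Real.log (1 + y))
        - W * ((1 - z) * Real.log (1 - z)) - Real.log (1 + y) / 2 - Real.log (1 - z) / 2 + r := by
  obtain ⟨r₁, h₁, h₁', e₁⟩ := exists_log_factorial_eq (n := M) (by omega)
  obtain ⟨r₂, h₂, h₂', e₂⟩ := exists_log_factorial_eq (n := u) (by omega)
  obtain ⟨r₃, h₃, h₃', e₃⟩ := exists_log_factorial_eq (n := M - u) (by omega)
  have hMu : ((M - u : ℕ) : ℝ) = M - u := Nat.cast_sub huM.le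
  have hM : (0 : ℝ) < M := by exact_mod_cast (by omega : 0 < M)
  have hu' : (0 : ℝ) < u := by exact_mod_cast hu
  have hMu' : (0 : ℝ) < (M : ℝ) - u := sub_pos.mpr (by exact_mod_cast huM)
  have hq : 0 < 1 - p := by linarith
  have hm0 : 0 < m := hm ▸ mul_pos hM hp0
  have hW0 : 0 < W := hW ▸ mul_pos hM hq
  have hy0 : 0 < 1 + y := by
    rw [hy] at hu'
    exact pos_of_mul_pos_right hu' hm0.le
  have hz0 : 0 < 1 - z := by
    rw [hz] at hMu'
    exact pos_of_mul_pos_right hMu' hW0.le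
  rw [hMu] at h₃' e₃
  refine ⟨r₁ - r₂ - r₃, ?_, ?_⟩
  · rw [abs_le]
    constructor <;> linarith
  · have hb : Real.log (binomialMass M u p) = Real.log M.factorial - Real.log u.factorial -
        Real.log (M - u).factorial + u * Real.log p + (M - u) * Real.log (1 - p) := by
      rw [binomialMass, Nat.cast_choose ℝ huM.le, Real.log_mul (by positivity) (by positivity),
        Real.log_mul (by positivity) (by positivity), Real.log_div (by positivity) (by positivity),
        Real.log_mul (by positivity) (by positivity), Real.log_pow, Real.log_pow, hMu]
      ring
    have lu : Real.log u = Real.log M + Real.log p + Real.log (1 + y) := by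
      rw [hy, Real.log_mul hm0.ne' hy0.ne', hm, Real.log_mul hM.ne' hp0.ne']
    have lMu : Real.log ((M : ℝ) - u) = Real.log M + Real.log (1 - p) + Real.log (1 - z) := by
      rw [hz, Real.log_mul hW0.ne' hz0.ne', hW, Real.log_mul hM.ne' hq.ne']
    have lm : Real.log (m * (1 - p)) = Real.log M + Real.log p + Real.log (1 - p) := by
      rw [hm, Real.log_mul (by positivity) hq.ne', Real.log_mul hM.ne' hp0.ne']
    rw [hb, e₁, e₂, e₃, lm, lu, lMu, ← mul_assoc m, ← mul_assoc W, ← hy, ← hz]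
    ring

theorem stdNormalDensity_eq (x : ℝ) :
    stdNormalDensity x = (√(2 * Real.pi))⁻¹ * Real.exp (-(x ^ 2 / 2)) := by
  rw [stdNormalDensity, gaussianPDFReal, NNReal.coe_one, mul_one, mul_one, sub_zero, neg_div]

theorem sum_one_div_le_one_div_sqrt {m a b c : ℝ} (hm : 1 ≤ m) (ha : m / 2 ≤ a) (hb : m / 2 ≤ b)
    (hc : m / 2 ≤ c) : 1 / (12 * a) + 1 / (12 * b) + 1 / (12 * c) ≤ 1 / √m := by
  have hm0 : 0 < m := by linarith
  have key : ∀ a, m / 2 ≤ a → 1 / (12 * a) ≤ 1 / (6 * m) := fun a ha =>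
    one_div_le_one_div_of_le (by linarith) (by linarith)
  have h4 : 1 / (6 * m) + 1 / (6 * m) + 1 / (6 * m) ≤ 1 / m := by
    rw [← add_div, ← add_div, div_le_div_iff₀ (by linarith) hm0]
    linarith
  have h5 : 1 / m ≤ 1 / √m :=
    one_div_le_one_div_of_le (Real.sqrt_pos.mpr hm0) ((Real.sqrt_le_left (by linarith)).mpr (by nlinarith))
  linarith [key a ha, key b hb, key c hc]

/-- Both cubic terms are |x| times a square, and |z| ≤ |y|, so the bound for successes also covers
failures. -/
theorem cubic_error_le {K m W x y z : ℝ} (hm0 : 0 < m) (hW0 : 0 < W)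
    (hmy : m * y = x) (hWz : W * z = x) (hym : |y| ≤ K / √m) (hzy : |z| ≤ |y|) :
    m * |y| ^ 3 ≤ K ^ 3 / √m ∧ W * |z| ^ 3 ≤ K ^ 3 / √m := by
  have hs0 : 0 < √m := Real.sqrt_pos.mpr hm0
  have hss : √m ^ 2 = m := Real.sq_sqrt hm0.le
  have hmy3 : m * |y| ^ 3 ≤ K ^ 3 / √m := by
    calc m * |y| ^ 3 ≤ m * (K / √m) ^ 3 := by gcongr
      _ = √m ^ 2 * (K / √m) ^ 3 := by rw [hss]
      _ = K ^ 3 / √m := by field_simp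
  refine ⟨hmy3, le_trans ?_ hmy3⟩
  have e1 : W * |z| = |x| := by rw [← hWz, abs_mul, abs_of_pos hW0]
  have e2 : m * |y| = |x| := by rw [← hmy, abs_mul, abs_of_pos hm0]
  calc W * |z| ^ 3 = |x| * |z| ^ 2 := by rw [← e1]; ring
    _ ≤ |x| * |y| ^ 2 := by gcongr
    _ = m * |y| ^ 3 := by rw [← e2]; ring

theorem abs_sum_errors_le {m W e₁ e₂ l₁ l₂ r Y Z A B D : ℝ} (hm : 0 < m) (hW : 0 < W)
    (b₁ : |e₁| ≤ 4 * Y) (b₂ : |e₂| ≤ 4 * Z) (hY : m * Y ≤ A) (hZ : W * Z ≤ A)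
    (h₁ : |l₁| ≤ 2 * B) (h₂ : |l₂| ≤ 2 * B) (hr : |r| ≤ D) :
    |-(m * e₁) - W * e₂ - l₁ / 2 - l₂ / 2 + r| ≤ 8 * A + 2 * B + D := by
  have c₁ : |m * e₁| ≤ 4 * A := by
    rw [abs_mul, abs_of_pos hm]
    linarith [mul_le_mul_of_nonneg_left b₁ hm.le]
  have c₂ : |W * e₂| ≤ 4 * A := by
    rw [abs_mul, abs_of_pos hW]
    linarith [mul_le_mul_of_nonneg_left b₂ hW.le]
  rw [abs_le] at c₁ c₂ h₁ h₂ hr ⊢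
  constructor <;> linarith

/-- The exponential form of a Gaussian mass. -/
theorem exp_log_gaussian {v x δ : ℝ} (hv : 0 < v) :
    Real.exp (-(Real.log (2 * Real.pi) / 2) - Real.log v / 2 - x ^ 2 / v / 2 + δ) =
      1 / √v * stdNormalDensity (x / √v) * Real.exp δ := by
  rw [stdNormalDensity_eq, div_pow, Real.sq_sqrt hv.le, Real.exp_add, Real.exp_sub, Real.exp_sub,
    Real.exp_neg, ← Real.log_sqrt (by positivity), ← Real.log_sqrt hv.le,
    Real.exp_log (by positivity), Real.exp_log (by positivity), Real.exp_neg]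
  field_simp

/-- The local central limit theorem for binomial laws, with a rate. -/
theorem binomialMass_eq_gaussian {K : ℝ} (hK : 0 ≤ K) {M u : ℕ} {p m : ℝ} (hp0 : 0 < p)
    (hp1 : p ≤ 1 / 2) (hm : m = M * p) (hm1 : 1 ≤ m) (hm2 : 4 * K ^ 2 ≤ m)
    (hm3 : (8 * K ^ 3 + 2 * K + 1) ^ 2 ≤ m) (hu : |(u : ℝ) - m| ≤ K * √m) :
    ∃ ε : ℝ, |ε| ≤ 2 * (8 * K ^ 3 + 2 * K + 1) / √m ∧
      binomialMass M u p = 1 / √(m * (1 - p)) *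
        stdNormalDensity ((u - m) / √(m * (1 - p))) * (1 + ε) := by
  have hm0 : 0 < m := by linarith
  have hs1 : 1 ≤ √m := Real.one_le_sqrt.mpr hm1
  have hs0 : 0 < √m := by linarith
  have hss : √m * √m = m := Real.mul_self_sqrt hm0.le
  have hKs : 2 * K ≤ √m := Real.le_sqrt_of_sq_le (by linarith)
  have hq : 1 / 2 ≤ 1 - p := by linarith
  have hq0 : 0 < 1 - p := by linarith
  set W : ℝ := M * (1 - p) with hW
  have hM : (M : ℝ) = m + W := by rw [hW, hm]; ring
  have hmW : m ≤ W := by rw [hm, hW]; gcongr; linarith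
  have hW0 : 0 < W := by linarith
  set x : ℝ := u - m with hx
  set y : ℝ := x / m with hy
  set z : ℝ := x / W with hz
  have hmy : m * y = x := mul_div_cancel₀ _ hm0.ne'
  have hWz : W * z = x := mul_div_cancel₀ _ hW0.ne'
  have hym : |y| ≤ K / √m := by
    rw [hy, abs_div, abs_of_pos hm0, div_le_div_iff₀ hm0 hs0]
    calc |x| * √m ≤ K * √m * √m := by gcongr
      _ = K * m := by rw [mul_assoc, hss]
  have hzy : |z| ≤ |y| := by
    rw [hy, hz, abs_div, abs_div, abs_of_pos hm0, abs_of_pos hW0]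
    gcongr
  have hy2 : |y| ≤ 1 / 2 := hym.trans (by rw [div_le_div_iff₀ hs0 two_pos]; linarith)
  have hz2 : |-z| ≤ 1 / 2 := by rw [abs_neg]; linarith
  have hux : (u : ℝ) = m * (1 + y) := by rw [mul_add, hmy, hx]; ring
  have hMux : (M : ℝ) - u = W * (1 - z) := by rw [mul_sub, hWz, hM, hx]; ring
  have hu2 : m / 2 ≤ u := by
    rw [hux]
    nlinarith [(abs_le.mp hy2).1]
  have hMu2 : m / 2 ≤ (M : ℝ) - u := by
    rw [hMux]
    nlinarith [(abs_le.mp hz2).1]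
  have hu0 : 0 < u := by
    have : (0 : ℝ) < u := by linarith
    exact_mod_cast this
  have huM : u < M := by
    have : (u : ℝ) < M := by linarith
    exact_mod_cast this
  obtain ⟨r, hr, hlog⟩ := log_binomialMass_eq hp0 (by linarith : p < 1) hu0 huM hm hW hux hMux
  clear_value x y z W
  have hpos : 0 < binomialMass M u p := by
    unfold binomialMass
    have := Nat.choose_pos huM.le
    positivity
  set C : ℝ := 8 * K ^ 3 + 2 * K + 1 with hC
  have hr' : |r| ≤ 1 / √m :=
    hr.trans (sum_one_div_le_one_div_sqrt hm1 (by linarith) hu2 hMu2)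
  obtain ⟨hmy3, hWz3⟩ := cubic_error_le hm0 hW0 hmy hWz hym hzy
  set e₁ : ℝ := (1 + y) * Real.log (1 + y) - (y + y ^ 2 / 2) with he₁
  set e₂ : ℝ := (1 + -z) * Real.log (1 + -z) - (-z + (-z) ^ 2 / 2) with he₂
  have b₁ : |e₁| ≤ 4 * |y| ^ 3 := abs_one_add_mul_log_sub_le hy2
  have b₂ : |e₂| ≤ 4 * |z| ^ 3 := by
    have := abs_one_add_mul_log_sub_le hz2
    rwa [abs_neg z] at this
  have l₁ := abs_log_one_add_le hy2
  have l₂ := abs_log_one_add_le hz2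
  rw [abs_neg] at l₂
  set δ : ℝ := -(m * e₁) - W * e₂ - Real.log (1 + y) / 2 - Real.log (1 + -z) / 2 + r with hδ
  have hδC : |δ| ≤ C / √m := by
    have c₅ : C / √m = 8 * (K ^ 3 / √m) + 2 * (K / √m) + 1 / √m := by rw [hC]; ring
    rw [c₅, hδ]
    exact abs_sum_errors_le hm0 hW0 b₁ b₂ hmy3 hWz3 (by linarith) (by linarith) hr'
  have hC0 : 0 ≤ C := by positivity
  -- The threshold `hm3` serves this bound, under which |exp δ - 1| ≤ 2|δ|.
  have hδ1 : |δ| ≤ 1 := hδC.trans (by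
    rw [div_le_one hs0]
    exact Real.le_sqrt_of_sq_le hm3)
  refine ⟨Real.exp δ - 1, ?_, ?_⟩
  · refine (Real.abs_exp_sub_one_le hδ1).trans ?_
    rw [mul_div_assoc]
    gcongr
  · have hmq : 0 < m * (1 - p) := by positivity
    -- Since m + W = M, the two quadratic terms combine to the binomial variance m(1-p).
    have hvar : x ^ 2 / m + x ^ 2 / W = x ^ 2 / (m * (1 - p)) := by
      have hMp : (M : ℝ) ≠ 0 := by rw [hM]; positivity
      rw [hW, hm]
      field_simp
      ring
    have hlog' : Real.log (binomialMass M u p) = -(Real.log (2 * Real.pi) / 2) -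
        Real.log (m * (1 - p)) / 2 - x ^ 2 / (m * (1 - p)) / 2 + δ := by
      rw [hlog, ← hvar, hδ, he₁, he₂]
      have f1 : x ^ 2 / m = m * y ^ 2 := by rw [hy]; field_simp
      have f2 : x ^ 2 / W = W * z ^ 2 := by rw [hz]; field_simp
      rw [f1, f2]
      -- The first-order terms cancel, because m y and W z both equal x.
      linear_combination hWz - hmy
    rw [← Real.exp_log hpos, hlog', exp_log_gaussian hmq, add_sub_cancel]

/-! ### Exponential bounds away from the mean -/

theorem binomialMass_nonneg (M u : ℕ) {p : ℝ} (hp0 : 0 ≤ p) (hp1 : p ≤ 1) :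
    0 ≤ binomialMass M u p := by
  have : 0 ≤ 1 - p := by linarith
  unfold binomialMass
  positivity

/-- The left side is one term of the generating function (1 - p + ps)^M. -/
theorem binomialMass_mul_pow_le (M u : ℕ) {p s : ℝ} (hp0 : 0 ≤ p) (hp1 : p ≤ 1) (hs : 0 ≤ s) :
    binomialMass M u p * s ^ u ≤ Real.exp (M * p * (s - 1)) := by
  have hq : 0 ≤ 1 - p := by linarith
  rcases lt_or_ge M u with h | h
  · rw [binomialMass, Nat.choose_eq_zero_of_lt h]
    simp [Real.exp_nonneg]
  · calc binomialMass M u p * s ^ u = (p * s) ^ u * (1 - p) ^ (M - u) * (M.choose u : ℝ) := by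
          rw [binomialMass, mul_pow]; ring
      _ ≤ (p * s + (1 - p)) ^ M := by
          rw [add_pow]
          exact Finset.single_le_sum
            (f := fun i => (p * s) ^ i * (1 - p) ^ (M - i) * (M.choose i : ℝ))
            (fun i _ => by positivity) (Finset.mem_range.mpr (by omega))
      _ ≤ (Real.exp (p * (s - 1))) ^ M := by
          gcongr
          have := Real.add_one_le_exp (p * (s - 1))
          linarith
      _ = Real.exp (M * p * (s - 1)) := by rw [← Real.exp_nat_mul]; ring_nf

theorem binomialMass_le_exp (M u : ℕ) {p s : ℝ} (hp0 : 0 ≤ p) (hp1 : p ≤ 1) (hs : 0 < s) :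
    binomialMass M u p ≤ Real.exp (M * p * (s - 1) - u * Real.log s) := by
  rw [Real.exp_sub, Real.exp_nat_mul, Real.exp_log hs, le_div_iff₀ (by positivity)]
  exact binomialMass_mul_pow_le M u hp0 hp1 hs.le

theorem exists_binomialMass_le_exp_neg {θ : ℝ} (h0 : 0 < θ) (h1 : θ < 1) :
    ∃ a > 0, ∃ δ > 0, ∀ (M u : ℕ) (p m : ℝ), 0 ≤ m → 0 ≤ p → p ≤ 1 → |(u : ℝ) - m| ≤ δ * m →
      (M * p ≤ θ * m ∨ 2 * m ≤ M * p) → binomialMass M u p ≤ Real.exp (-(a * m)) := by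
  set l : ℝ := Real.log θ⁻¹ with hl
  have hl1 : 1 - θ < l := by
    have := Real.log_lt_sub_one_of_pos h0 h1.ne
    rw [hl, Real.log_inv]
    linarith
  have hl0 : 0 < l := by linarith
  -- Small means use the tilt s = 1/θ, with gain l - (1-θ) > 0: half pays for the deviation of u,
  -- half is the rate. Large means use s = 1/2, where 1 - (5/4)·0.7 = 1/8.
  refine ⟨min (1 / 8) ((l - (1 - θ)) / 2), lt_min (by norm_num) (by linarith),
    min (1 / 4) ((l - (1 - θ)) / (2 * l)), lt_min (by norm_num) (div_pos (by linarith)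
      (by linarith)), fun M u p m hm hp0 hp1 hu hMp => ?_⟩
  rw [abs_le] at hu
  rcases hMp with hMp | hMp
  · refine (binomialMass_le_exp M u hp0 hp1 (inv_pos.mpr h0)).trans (Real.exp_le_exp.mpr ?_)
    have hδ : min (1 / 4) ((l - (1 - θ)) / (2 * l)) * m ≤ (l - (1 - θ)) / (2 * l) * m := by
      gcongr; exact min_le_right _ _
    have ha : min (1 / 8) ((l - (1 - θ)) / 2) * m ≤ (l - (1 - θ)) / 2 * m := by
      gcongr; exact min_le_right _ _
    have hi : 0 ≤ θ⁻¹ - 1 := by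
      have := (one_le_inv₀ h0).mpr h1.le
      linarith
    have e1 : M * p * (θ⁻¹ - 1) ≤ (1 - θ) * m := by
      calc M * p * (θ⁻¹ - 1) ≤ θ * m * (θ⁻¹ - 1) := by gcongr
        _ = (1 - θ) * m := by field_simp
    have e2 : (m - (l - (1 - θ)) / (2 * l) * m) * l ≤ u * l := by
      gcongr
      linarith [hu.1]
    have e3 : (m - (l - (1 - θ)) / (2 * l) * m) * l = m * l - (l - (1 - θ)) / 2 * m := by
      field_simp
    linarith
  · refine (binomialMass_le_exp M u hp0 hp1 (by norm_num : (0 : ℝ) < 2⁻¹)).trans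
      (Real.exp_le_exp.mpr ?_)
    have hδ : min (1 / 4) ((l - (1 - θ)) / (2 * l)) * m ≤ 1 / 4 * m := by
      gcongr; exact min_le_left _ _
    have ha : min (1 / 8) ((l - (1 - θ)) / 2) * m ≤ 1 / 8 * m := by
      gcongr; exact min_le_left _ _
    have hu' : (u : ℝ) * Real.log 2 ≤ 5 / 4 * m * 0.7 := by
      have := Real.log_two_lt_d9
      have := Real.log_two_gt_d9
      gcongr
      · linarith [hu.2]
      · linarith
    rw [Real.log_inv]
    nlinarith

/-! ### Main term, remainder and their comparison -/

theorem closedDegree_div_le_one {N : ℕ} [NeZero N] (G : SimpleGraph (Fin N))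
    (V₁ V₂ : Finset (Fin N)) {n : ℕ} (x : Fin n → Fin N) :
    (closedDegree G V₁ V₂ x : ℝ) / (N : ℝ) ^ n ≤ 1 := by
  have hN : (0 : ℝ) < N := by exact_mod_cast NeZero.pos N
  rw [div_le_one (by positivity)]
  have : closedDegree G V₁ V₂ x ≤ N ^ n := by
    classical
    simpa [closedDegree] using
      Finset.card_le_univ (Finset.univ.filter fun y : Fin n → Fin N => HierAdj G V₁ V₂ x y)
  exact_mod_cast this

theorem degreeProb_split {N : ℕ} [NeZero N] (G : SimpleGraph (Fin N)) (V₁ V₂ : Finset (Fin N))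
    {n k M u : ℕ} {T B : ℝ} (hkn : k < n) (hB : 0 ≤ B)
    (h1 : ∀ x ∈ runWords V₁ V₂ n k, (closedDegree G V₁ V₂ x : ℝ) = T)
    (h2 : ∀ x ∉ runWords V₁ V₂ n k,
      binomialMass M u ((closedDegree G V₁ V₂ x : ℝ) / (N : ℝ) ^ n) ≤ B) :
    ∃ R : ℝ, 0 ≤ R ∧ R ≤ B ∧ degreeProb G V₁ V₂ n M u =
      ((V₁.card : ℝ) / N) ^ k * ((V₂.card : ℝ) / N) * binomialMass M u (T / (N : ℝ) ^ n) + R := by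
  classical
  have hN : (0 : ℝ) < N := by exact_mod_cast NeZero.pos N
  refine ⟨∑ x ∈ (runWords V₁ V₂ n k)ᶜ, 1 / (N : ℝ) ^ n *
        binomialMass M u (closedDegree G V₁ V₂ x / (N : ℝ) ^ n), ?_, ?_, ?_⟩
  · exact Finset.sum_nonneg fun x _ => mul_nonneg (by positivity)
      (binomialMass_nonneg M u (by positivity) (closedDegree_div_le_one G V₁ V₂ x))
  · calc _ ≤ ∑ x ∈ (runWords V₁ V₂ n k)ᶜ, 1 / (N : ℝ) ^ n * B := by
          refine Finset.sum_le_sum fun x hx => ?_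
          gcongr
          exact h2 x (Finset.mem_compl.mp hx)
      _ ≤ ∑ x : Fin n → Fin N, 1 / (N : ℝ) ^ n * B :=
          Finset.sum_le_sum_of_subset_of_nonneg (Finset.subset_univ _)
            fun _ _ _ => by positivity
      _ = B := by
          simp [hN.ne']
  · rw [degreeProb_eq_sum, ← Finset.sum_add_sum_compl (runWords V₁ V₂ n k)]
    congr 1
    rw [Finset.sum_congr rfl fun x hx => by rw [h1 x hx], Finset.sum_const, card_runWords _ _ hkn,
      nsmul_eq_mul]
    obtain ⟨a, rfl⟩ : ∃ a, n = a + 1 + k := ⟨n - k - 1, by omega⟩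
    rw [show a + 1 + k - k - 1 = a by omega]
    push_cast
    rw [pow_add, pow_succ, div_pow]
    field_simp

/-- Within the window the Gaussian is of order at least 1/√m: p ≤ 1/2 keeps the variance above m/2,
so the exponent is at most K². -/
theorem exp_div_sqrt_le_gaussian {K m p x : ℝ} (hm : 0 < m) (hp0 : 0 ≤ p) (hp1 : p ≤ 1 / 2)
    (hx : |x| ≤ K * √m) :
    (√(2 * Real.pi))⁻¹ * Real.exp (-K ^ 2) / √m ≤
      1 / √(m * (1 - p)) * stdNormalDensity (x / √(m * (1 - p))) := by
  have hq : 1 / 2 ≤ 1 - p := by linarith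
  have hv : 0 < m * (1 - p) := by positivity
  have hx2 : x ^ 2 ≤ K ^ 2 * m := by
    have := pow_le_pow_left₀ (abs_nonneg x) hx 2
    rwa [sq_abs, mul_pow, Real.sq_sqrt hm.le] at this
  rw [stdNormalDensity_eq, div_pow, Real.sq_sqrt hv.le, div_eq_mul_one_div, mul_comm]
  gcongr
  · nlinarith
  · rw [div_div, div_le_iff₀ (by positivity)]
    nlinarith [mul_nonneg (mul_nonneg (sq_nonneg K) hm.le) (by linarith : (0:ℝ) ≤ 1 - p - 1 / 2)]

theorem sqrt_mul_exp_neg_le {a m : ℝ} (ha : 0 < a) (hm : 0 < m) :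
    √m * Real.exp (-(a * m)) ≤ 1 / a / √m := by
  have hs : 0 < √m := Real.sqrt_pos.mpr hm
  rw [le_div_iff₀ hs, Real.exp_neg, le_div_iff₀ ha]
  have h1 := Real.add_one_le_exp (a * m)
  have hss : √m * √m = m := Real.mul_self_sqrt hm.le
  calc √m * (Real.exp (a * m))⁻¹ * √m * a = (a * m) * (Real.exp (a * m))⁻¹ := by
        rw [← hss, Real.mul_self_sqrt hm.le]; linear_combination (Real.exp (a * m))⁻¹ * a * hss
    _ ≤ Real.exp (a * m) * (Real.exp (a * m))⁻¹ := by gcongr; linarith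
    _ = 1 := mul_inv_cancel₀ (Real.exp_ne_zero _)

/-- Half of the decay exp(-am) absorbs N^k; the other half absorbs √m and leaves 1/√m. -/
theorem remainder_div_le {N n₁ n₂ k : ℕ} {a c T m K R g : ℝ} (hN : 0 < N) (hn₁ : 1 ≤ n₁)
    (hn₂ : 1 ≤ n₂) (ha : 0 < a) (hc : 2 * N / a ≤ c) (hkT : (k : ℝ) ≤ T) (hm : m = c * T)
    (hm0 : 0 < m) (hR : R ≤ Real.exp (-(a * m)))
    (hg : (√(2 * Real.pi))⁻¹ * Real.exp (-K ^ 2) / √m ≤ g) :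
    R / (((n₁ : ℝ) / N) ^ k * ((n₂ : ℝ) / N) * g) ≤
      √(2 * Real.pi) * Real.exp (K ^ 2) * N * (2 / a) / √m := by
  have hN' : (0 : ℝ) < N := by exact_mod_cast hN
  have hs : 0 < √m := Real.sqrt_pos.mpr hm0
  have hw : ((1 : ℝ) / N) ^ k * (1 / N) ≤ ((n₁ : ℝ) / N) ^ k * ((n₂ : ℝ) / N) := by
    have h1 : (1 : ℝ) ≤ n₁ := by exact_mod_cast hn₁
    have h2 : (1 : ℝ) ≤ n₂ := by exact_mod_cast hn₂
    gcongr
  have hNk : (N : ℝ) ^ k ≤ Real.exp (a / 2 * m) := by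
    have h1 : (N : ℝ) ≤ Real.exp N := by linarith [Real.add_one_le_exp (N : ℝ)]
    calc (N : ℝ) ^ k ≤ Real.exp N ^ k := by gcongr
      _ = Real.exp (k * N) := (Real.exp_nat_mul _ _).symm
      _ ≤ Real.exp (a / 2 * m) := by
        apply Real.exp_le_exp.mpr
        rw [div_le_iff₀ ha] at hc
        have hT : 0 ≤ T := (Nat.cast_nonneg k).trans hkT
        calc (k : ℝ) * N ≤ T * N := by gcongr
          _ ≤ T * (c * a / 2) := by gcongr; linarith
          _ = a / 2 * m := by rw [hm]; ring
  calc R / (((n₁ : ℝ) / N) ^ k * ((n₂ : ℝ) / N) * g)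
      ≤ Real.exp (-(a * m)) / (((1 : ℝ) / N) ^ k * (1 / N) *
          ((√(2 * Real.pi))⁻¹ * Real.exp (-K ^ 2) / √m)) := by gcongr
    _ = √(2 * Real.pi) * Real.exp (K ^ 2) * N * ((N : ℝ) ^ k * (√m * Real.exp (-(a * m)))) := by
        rw [Real.exp_neg (K ^ 2), div_pow, one_pow]
        field_simp
    _ ≤ √(2 * Real.pi) * Real.exp (K ^ 2) * N *
          (Real.exp (a / 2 * m) * (√m * Real.exp (-(a * m)))) := by gcongr
    _ = √(2 * Real.pi) * Real.exp (K ^ 2) * N * (√m * Real.exp (-(a / 2 * m))) := by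
        have : Real.exp (-(a * m)) = Real.exp (-(a / 2 * m)) * Real.exp (-(a / 2 * m)) := by
          rw [← Real.exp_add]; ring_nf
        rw [this, Real.exp_neg]
        field_simp
    _ ≤ √(2 * Real.pi) * Real.exp (K ^ 2) * N * (1 / (a / 2) / √m) := by
        gcongr
        exact sqrt_mul_exp_neg_le (by linarith) hm0
    _ = _ := by rw [one_div_div]; ring

theorem eventually_urnDegree_div_le {N d₁ : ℕ} (hd₁ : 2 ≤ d₁) (hdN : d₁ < N) :
    ∀ᶠ n in atTop, ∀ k : ℕ, k < n → urnDegree d₁ k / (N : ℝ) ^ n ≤ 1 / 2 := by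
  have hN : (0 : ℝ) < N := by exact_mod_cast (by omega : 0 < N)
  have hlt : (d₁ : ℝ) / N < 1 := by
    rw [div_lt_one hN]
    exact_mod_cast hdN
  have h := (tendsto_pow_atTop_nhds_zero_of_lt_one (by positivity) hlt).eventually_le_const
    (by norm_num : (0 : ℝ) < 1 / 2)
  filter_upwards [h] with n hn k hk
  refine le_trans ?_ hn
  rw [div_pow]
  gcongr
  rw [urnDegree_eq_geom_sum hd₁]
  have h1 : ∑ j ∈ Finset.range (k + 1), d₁ ^ j < d₁ ^ (k + 1) :=
    Nat.geomSum_lt hd₁ fun j hj => Finset.mem_range.mp hj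
  have h2 : d₁ ^ (k + 1) ≤ d₁ ^ n := Nat.pow_le_pow_right (by omega) hk
  exact_mod_cast h1.le.trans h2

/-- The factor d/(d+1) comes from keeping only the last two terms of t_k; the factor 2 from t_{k+1}
= 1 + d t_k. -/
theorem urnDegree_bounds {d k : ℕ} (hd : 2 ≤ d) (hk : 0 < k) :
    (k : ℝ) ≤ urnDegree d k ∧ 1 ≤ urnDegree d k ∧
      (d : ℝ) ^ k ≤ (d : ℝ) / (d + 1) * urnDegree d k ∧
      2 * urnDegree d k ≤ ((∑ j ∈ Finset.range (k + 2), d ^ j : ℕ) : ℝ) := by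
  rw [urnDegree_eq_geom_sum hd]
  have hk1 : k + 1 ≤ ∑ j ∈ Finset.range (k + 1), d ^ j := by
    simpa using Finset.card_nsmul_le_sum (Finset.range (k + 1)) (fun j => d ^ j) 1
      fun j _ => Nat.one_le_pow _ _ (by omega)
  refine ⟨by exact_mod_cast (by omega), by exact_mod_cast (by omega), ?_, ?_⟩
  · rw [div_mul_eq_mul_div, le_div_iff₀ (by positivity)]
    obtain ⟨j, rfl⟩ : ∃ j, k = j + 1 := ⟨k - 1, by omega⟩
    have h : d ^ (j + 1) * (d + 1) ≤ d * ∑ i ∈ Finset.range (j + 1 + 1), d ^ i := by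
      rw [Finset.sum_range_succ, Finset.sum_range_succ]
      have : d ^ (j + 1) * (d + 1) = d * (d ^ j + d ^ (j + 1)) := by ring
      rw [this]
      gcongr
      omega
    exact_mod_cast h
  · have h : 2 * ∑ j ∈ Finset.range (k + 1), d ^ j ≤ ∑ j ∈ Finset.range (k + 2), d ^ j := by
      rw [Finset.sum_range_succ' _ (k + 1)]
      simp only [pow_succ]
      rw [← Finset.sum_mul]
      nlinarith
    exact_mod_cast h

theorem exists_degreeProb_eq_gaussian {N : ℕ} [NeZero N] (G : SimpleGraph (Fin N))
    [DecidableRel G.Adj] (V₁ V₂ : Finset (Fin N)) (hV₁ : V₁.Nonempty) (hV₂ : V₂.Nonempty)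
    (hV : IsCompl V₁ V₂) (hG : G.IsBipartiteWith (V₁ : Set (Fin N)) (V₂ : Set (Fin N)))
    (d₁ d₂ : ℕ) (hd₁ : ∀ x ∈ V₁, G.degree x = d₁) (hd₂ : ∀ x ∈ V₂, G.degree x ≤ d₂)
    (hd : d₂ + 1 ≤ d₁) (K : ℝ) :
    ∃ C : ℝ, 0 ≤ C ∧ ∀ (M : ℕ → ℕ) (c : ℕ → ℝ), (∀ n, (M n : ℝ) = c n * (N : ℝ) ^ n) →
      Tendsto c atTop atTop →
      ∀ᶠ n in atTop, ∀ k : ℕ, kZero d₁ d₂ n < k → k < n →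
        0 < c n * urnDegree d₁ k ∧ 0 ≤ urnDegree d₁ k / (N : ℝ) ^ n ∧
        urnDegree d₁ k / (N : ℝ) ^ n ≤ 1 / 2 ∧
        ∀ u : ℕ, (u : ℝ) ∈ window K (c n * urnDegree d₁ k) →
          ∃ ε : ℝ, |ε| ≤ C / √(c n * urnDegree d₁ k) ∧
            degreeProb G V₁ V₂ n (M n) u =
              ((V₁.card : ℝ) / N) ^ k * ((V₂.card : ℝ) / N) *
                (1 / √(c n * urnDegree d₁ k * (1 - urnDegree d₁ k / (N : ℝ) ^ n))) *
                stdNormalDensity (((u : ℝ) - c n * urnDegree d₁ k) /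
                    √(c n * urnDegree d₁ k * (1 - urnDegree d₁ k / (N : ℝ) ^ n))) *
                (1 + ε) := by
  have h2 := one_le_of_degree hV₁ hG hd₁ hd₂ hd
  have hd1 : 2 ≤ d₁ := by omega
  have hdN := degree_lt_card hV₁ hd₁
  have hN : (0 : ℝ) < N := by exact_mod_cast NeZero.pos N
  have hd0 : (0 : ℝ) < d₁ := by exact_mod_cast (by omega : 0 < d₁)
  obtain ⟨a, ha, δ, hδ, htail⟩ := exists_binomialMass_le_exp_neg
    (θ := (d₁ : ℝ) / (d₁ + 1)) (by positivity) (by rw [div_lt_one (by positivity)]; linarith)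
  set L : ℝ := |K| with hL
  have hL0 : 0 ≤ L := abs_nonneg K
  refine ⟨2 * (8 * L ^ 3 + 2 * L + 1) + √(2 * Real.pi) * Real.exp (L ^ 2) * N * (2 / a),
    by positivity, fun M c hM hc => ?_⟩
  -- As t_k ≥ 1, c_n ≤ m, so thresholds imposed on c_n hold for m uniformly in k.
  filter_upwards [eventually_urnDegree_div_le hd1 hdN, hc.eventually_ge_atTop 1,
    hc.eventually_ge_atTop (4 * L ^ 2), hc.eventually_ge_atTop ((8 * L ^ 3 + 2 * L + 1) ^ 2),
    hc.eventually_ge_atTop (2 * N / a), hc.eventually_ge_atTop ((L / δ) ^ 2)]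
    with n hp hc1 hc2 hc3 hc4 hc5 k hk0 hkn
  have hk : 0 < k := by
    have h := (max_lt_iff.mp hk0).2
    have : (0 : ℝ) < k := lt_of_le_of_lt
      (div_nonneg (Real.log_natCast_nonneg _) (Real.log_natCast_nonneg _)) h
    exact_mod_cast this
  obtain ⟨hT1, hT2, hT3, hT4⟩ := urnDegree_bounds hd1 hk
  have hTeq := urnDegree_eq_geom_sum hd1 k
  have hp1 := hp k hkn
  set T : ℝ := urnDegree d₁ k with hT
  set P : ℝ := T / (N : ℝ) ^ n with hP
  set m : ℝ := c n * T with hm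
  have hNn : (0 : ℝ) < (N : ℝ) ^ n := by positivity
  have hcm : c n ≤ m := by rw [hm]; nlinarith
  have hm0 : 0 < m := by linarith
  have hP0 : 0 < P := by positivity
  have hmP : m = M n * P := by
    rw [hm, hM, hP]
    field_simp
  refine ⟨hm0, hP0.le, hp1, fun u hu => ?_⟩
  have hx : |(u : ℝ) - m| ≤ L * √m := by
    have h1 : K * √m ≤ L * √m := by gcongr; exact le_abs_self K
    rw [abs_le]
    constructor <;> linarith [hu.1, hu.2]
  have hxδ : |(u : ℝ) - m| ≤ δ * m := by
    refine hx.trans ?_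
    have h1 : L / δ ≤ √m := Real.le_sqrt_of_sq_le (by linarith)
    rw [div_le_iff₀ hδ] at h1
    calc L * √m ≤ √m * δ * √m := by gcongr
      _ = δ * (√m * √m) := by ring
      _ = δ * m := by rw [Real.mul_self_sqrt hm0.le]
  have htri := closedDegree_trichotomy hV₁ hV hG hd₁ hd₂ hd hk0 hk hkn
  have hMD : ∀ D : ℝ, M n * (D / (N : ℝ) ^ n) = c n * D := fun D => by
    rw [hM]
    field_simp
  obtain ⟨R, hR0, hR, hsplit⟩ := degreeProb_split G V₁ V₂ (M := M n) (u := u) (T := T)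
    (B := Real.exp (-(a * m))) hkn (Real.exp_nonneg _)
    (fun x hx => by rw [(htri x).1 hx, hTeq])
    (fun x hx => by
      refine htail (M n) u _ m hm0.le (by positivity) (closedDegree_div_le_one G V₁ V₂ x) hxδ ?_
      rw [hMD]
      have hc0 : 0 ≤ c n := by linarith
      rcases (htri x).2 hx with h | h
      · left
        have h' : (closedDegree G V₁ V₂ x : ℝ) ≤ (d₁ : ℝ) ^ k := by exact_mod_cast h
        calc c n * (closedDegree G V₁ V₂ x : ℝ) ≤ c n * ((d₁ : ℝ) / (d₁ + 1) * T) := by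
              gcongr
              exact h'.trans hT3
          _ = (d₁ : ℝ) / (d₁ + 1) * m := by rw [hm]; ring
      · right
        have h' : ((∑ j ∈ Finset.range (k + 2), d₁ ^ j : ℕ) : ℝ) ≤ closedDegree G V₁ V₂ x := by
          exact_mod_cast h
        calc 2 * m = c n * (2 * T) := by rw [hm]; ring
          _ ≤ c n * closedDegree G V₁ V₂ x := by
              gcongr
              exact hT4.trans h')
  obtain ⟨ε, hε, hb⟩ := binomialMass_eq_gaussian hL0 hP0 hp1 hmP (by linarith) (by linarith)
    (by linarith) hx
  have hg := exp_div_sqrt_le_gaussian hm0 hP0.le hp1 hx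
  set g : ℝ := 1 / √(m * (1 - P)) * stdNormalDensity ((u - m) / √(m * (1 - P))) with hgdef
  have hg0 : 0 < g := lt_of_lt_of_le (by positivity) hg
  have hrem := remainder_div_le (NeZero.pos N) hV₁.card_pos hV₂.card_pos ha hc4 hT1 hm hm0 hR hg
  set w : ℝ := ((V₁.card : ℝ) / N) ^ k * ((V₂.card : ℝ) / N) with hw
  have hw0 : 0 < w := by
    have h1 : (0 : ℝ) < V₁.card := by exact_mod_cast hV₁.card_pos
    have h2 : (0 : ℝ) < V₂.card := by exact_mod_cast hV₂.card_pos
    exact mul_pos (pow_pos (div_pos h1 hN) k) (div_pos h2 hN)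
  clear_value g w
  -- The contribution of the other words becomes a relative error of the main term w·g.
  refine ⟨ε + R / (w * g), ?_, ?_⟩
  · refine (abs_add_le _ _).trans ?_
    rw [add_div, abs_of_nonneg (a := R / _) (div_nonneg hR0 (mul_pos hw0 hg0).le)]
    exact add_le_add hε hrem
  · rw [hsplit, hb, mul_assoc w, ← hgdef]
    have h1 : w * g * (R / (w * g)) = R := mul_div_cancel₀ _ (mul_pos hw0 hg0).ne'
    rw [← add_assoc, mul_add (w * g) (1 + ε), h1, mul_assoc w g]

/-! ### Removing the variance correction from the normalisation -/

theorem one_div_sqrt_one_sub_bounds {p : ℝ} (hp0 : 0 ≤ p) (hp1 : p ≤ 1 / 2) :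
    1 ≤ 1 / √(1 - p) ∧ 1 / √(1 - p) ≤ 1 + 2 * p := by
  have hq : 0 < 1 - p := by linarith
  have hs : 0 < √(1 - p) := Real.sqrt_pos.mpr hq
  have hs1 : √(1 - p) ≤ 1 := Real.sqrt_le_one.mpr (by linarith)
  refine ⟨(one_le_div hs).mpr hs1, ?_⟩
  rw [div_le_iff₀ hs]
  have : 1 - p ≤ √(1 - p) := by nlinarith [Real.mul_self_sqrt hq.le]
  nlinarith

end HierGraph
end

theorem mainTheorem10 {N : ℕ} [NeZero N] (G : SimpleGraph (Fin N)) [DecidableRel G.Adj]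
    (V₁ V₂ : Finset (Fin N)) (hV₁ : V₁.Nonempty) (hV₂ : V₂.Nonempty) (hV : IsCompl V₁ V₂)
    (hG : G.IsBipartiteWith (V₁ : Set (Fin N)) (V₂ : Set (Fin N)))
    (d₁ d₂ : ℕ) (hd₁ : ∀ x ∈ V₁, G.degree x = d₁) (hd₂ : V₂.sup (fun y => G.degree y) = d₂)
    (hd : d₂ + 1 ≤ d₁)
    (K : ℝ) (hK : (gaussianReal 0 1).real {z : ℝ | K < |z|} < Real.exp (-10)) :
    (∃ C : ℝ, ∀ (M : ℕ → ℕ) (c : ℕ → ℝ), (∀ n, (M n : ℝ) = c n * (N : ℝ) ^ n) →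
      Tendsto c atTop atTop →
      ∀ᶠ n in atTop, ∀ k : ℕ, HierGraph.kZero d₁ d₂ n < k → k < n →
        ∀ u : ℕ, (u : ℝ) ∈ HierGraph.window K (c n * HierGraph.urnDegree d₁ k) →
          ∃ ε : ℝ, |ε| ≤ C / √(c n * HierGraph.urnDegree d₁ k) ∧
            HierGraph.degreeProb G V₁ V₂ n (M n) u =
              ((V₁.card : ℝ) / N) ^ k * ((V₂.card : ℝ) / N) *
                (1 / √(c n * HierGraph.urnDegree d₁ k *
                    (1 - HierGraph.urnDegree d₁ k / (N : ℝ) ^ n))) *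
                HierGraph.stdNormalDensity
                  (((u : ℝ) - c n * HierGraph.urnDegree d₁ k) /
                    √(c n * HierGraph.urnDegree d₁ k *
                      (1 - HierGraph.urnDegree d₁ k / (N : ℝ) ^ n))) *
                (1 + ε)) ∧
    (∀ A : ℝ, ∃ C : ℝ, ∀ (M : ℕ → ℕ) (c : ℕ → ℝ), (∀ n, (M n : ℝ) = c n * (N : ℝ) ^ n) →
      Tendsto c atTop atTop →
      ∀ᶠ n in atTop, ∀ k : ℕ, HierGraph.kZero d₁ d₂ n < k → k < n →
        HierGraph.urnDegree d₁ k / (N : ℝ) ^ n ≤ A / √(c n * HierGraph.urnDegree d₁ k) →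
        ∀ u : ℕ, (u : ℝ) ∈ HierGraph.window K (c n * HierGraph.urnDegree d₁ k) →
          ∃ ε : ℝ, |ε| ≤ C / √(c n * HierGraph.urnDegree d₁ k) ∧
            HierGraph.degreeProb G V₁ V₂ n (M n) u =
              ((V₁.card : ℝ) / N) ^ k * ((V₂.card : ℝ) / N) *
                (1 / √(c n * HierGraph.urnDegree d₁ k)) *
                HierGraph.stdNormalDensity
                  (((u : ℝ) - c n * HierGraph.urnDegree d₁ k) /
                    √(c n * HierGraph.urnDegree d₁ k *
                      (1 - HierGraph.urnDegree d₁ k / (N : ℝ) ^ n))) *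
                (1 + ε)) := by
  obtain ⟨C, hC, hmain⟩ := HierGraph.exists_degreeProb_eq_gaussian G V₁ V₂ hV₁ hV₂ hV hG d₁ d₂ hd₁
    (fun x hx => hd₂ ▸ Finset.le_sup (f := fun y => G.degree y) hx) hd K
  -- With s = 1/√(1-p) the new relative error is sε + (s-1), where s ≤ 2 and s - 1 ≤ 2p ≤ 2A/√m.
  refine ⟨⟨C, fun M c hM hc => ?_⟩, fun A => ⟨2 * C + 2 * A, fun M c hM hc => ?_⟩⟩
  · filter_upwards [hmain M c hM hc] with n hn k hk0 hkn
    exact (hn k hk0 hkn).2.2.2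
  · filter_upwards [hmain M c hM hc] with n hn k hk0 hkn hA u hu
    obtain ⟨hm0, hp0, hp1, h⟩ := hn k hk0 hkn
    obtain ⟨ε, hε, he⟩ := h u hu
    set p : ℝ := HierGraph.urnDegree d₁ k / (N : ℝ) ^ n
    set m : ℝ := c n * HierGraph.urnDegree d₁ k
    obtain ⟨hη0, hη⟩ := HierGraph.one_div_sqrt_one_sub_bounds hp0 hp1
    set s : ℝ := 1 / √(1 - p) with hs
    refine ⟨s * (1 + ε) - 1, ?_, ?_⟩
    · have h1 : s * (1 + ε) - 1 = s * ε + (s - 1) := by ring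
      calc |s * (1 + ε) - 1| ≤ |s| * |ε| + |s - 1| := by
            rw [h1, ← abs_mul]
            exact abs_add_le _ _
        _ ≤ 2 * (C / √m) + 2 * (A / √m) := by
            rw [abs_of_nonneg (by linarith : 0 ≤ s), abs_of_nonneg (by linarith : 0 ≤ s - 1)]
            gcongr
            · linarith
            · linarith
        _ = (2 * C + 2 * A) / √m := by ring
    · have hsq : 1 / √(m * (1 - p)) = 1 / √m * s := by
        rw [Real.sqrt_mul hm0.le, hs, div_mul_div_comm, one_mul]
      rw [he, hsq]
      ring
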